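/- Let $M$ be a connected, Hausdorff, paracompact smooth manifold of dimension $n\ge 1$, let $F\colon TM\to[0,\infty)$ be a (not necessarily reversible) Finsler metric on $M$, that is, $F$ is $C^\infty$ on $TM\setminus 0$, $F(\lambda v)=\lambda F(v)$ for $\lambda>0$, and the vertical Hessian of $\tfrac12F^2$ is positive definite at every $v\neq 0$. Let $\Lambda\colon M\to(0,\infty)$ be smooth, and consider the standard static Finsler spacetime $\tilde M=\mathbb R\times M$ with the Finsler function $L(\tau,v)=-\Lambda\tau^2+F(v)^2$. Write $T=\partial_t$, and let $\tilde g_w=\tfrac12\,\partial^2L/\partial v^i\partial v^j(w)$ be the vertical Hessian of $L$ at vectors $w\notin\mathbb R T$. A tangent vector $w$ of $\tilde M$ is causal if either $w$ is a non-zero multiple of $T$, or $w\notin\mathbb R T$ and $\tilde g_w(w,w)\le 0$; a causal vector is future-pointing if either it is a positive multiple of $T$, or $w\notin\mathbb R T$ and $\tilde g_w(w,T)<0$. A future-pointing causal curve is a continuous, piecewise smooth curve $\gamma\colon(a,b)\to\tilde M$, $-\infty\le a<b\le+\infty$ (finitely many break points in each compact subinterval), whose left and right derivatives are future-pointing causal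 at every parameter. It is inextensible if $\gamma(s)$ has no limit in $\tilde M$ as $s\to b^-$ and none as $s\to a^+$. A Cauchy hypersurface is a topological hypersurface of $\tilde M$ that is met exactly once by every inextensible future-pointing causal curve. Let $\tilde F=F/\sqrt\Lambda$ be the optical Finsler metric, and let $\tilde d(x,y)$ be its (in general non-symmetric) distance, the infimum of the lengths $\int\tilde F(\dot\sigma)\,ds$ of the continuous piecewise smooth curves $\sigma$ from $x$ to $y$. A sequence $(x_k)$ in $M$ is forward (resp. backward) Cauchy if for every $\varepsilon>0$ there is $\nu$ such that $\tilde d(x_j,x_k)<\varepsilon$ (resp. $\tilde d(x_k,x_j)<\varepsilon$) for all $k>j\ge\nu$; $(M,\tilde F)$ is forward (resp. backward) complete if every forward (resp. backward) Cauchy sequence converges in $M$. **Theorem.** For every $t\in\mathbb R$, the slice $S_t=\{t\}\times M$ is a Cauchy hypersurface of $(\tilde M,L)$ if and only if $(M,\tilde F)$ is both forward and backward complete. In particular, if one slice $S_t$ is a Cauchy hypersurface, then every slice $S_{t'}$, $t'\in\mathbb R$, is one. -/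

import Mathlib

open Set Filter Topology MeasureTheory
open scoped Manifold ContDiff ENNReal

noncomputable section

namespace StaticFinsler

/-! ### Curves in a manifold -/

section Curves

variable {E H N : Type*} [NormedAddCommGroup E] [NormedSpace ℝ E] [TopologicalSpace H]
  (I : ModelWithCorners ℝ E H) [TopologicalSpace N] [ChartedSpace H N]

/-- `γ` is a continuous piecewise smooth curve on the interval `J`: there is a set `P` of break
points, finitely many in each compact subinterval of `J`, such that `γ` is smooth on every compact
subinterval of `J` whose interior contains no break point. -/
def PiecewiseSmoothOn (γ : ℝ → N) (J : Set ℝ) : Prop :=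
  ContinuousOn γ J ∧
    ∃ P : Set ℝ, (∀ c d : ℝ, Icc c d ⊆ J → (P ∩ Icc c d).Finite) ∧
      ∀ c d : ℝ, c < d → Icc c d ⊆ J → Disjoint P (Ioo c d) →
        ContMDiffOn 𝓘(ℝ, ℝ) I ∞ γ (Icc c d)

/-- The right derivative of a curve at `s`. -/
def rightVelocity (γ : ℝ → N) (s : ℝ) : TangentSpace I (γ s) :=
  mfderivWithin 𝓘(ℝ, ℝ) I γ (Ici s) s (1 : ℝ)

/-- The left derivative of a curve at `s`. -/
def leftVelocity (γ : ℝ → N) (s : ℝ) : TangentSpace I (γ s) :=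
  mfderivWithin 𝓘(ℝ, ℝ) I γ (Iic s) s (1 : ℝ)

/-- The vertical Hessian `g_w(u₁, u₂) = (1/2) ∂²L/∂vⁱ∂vʲ(w) u₁ⁱ u₂ʲ` of a function `L` on the
tangent bundle. -/
def vertHessian (L : (p : N) → TangentSpace I p → ℝ) (p : N) (w u₁ u₂ : TangentSpace I p) : ℝ :=
  (1 / 2 : ℝ) * fderiv ℝ (fun z : E => fderiv ℝ (fun y : E => L p y) z) w u₁ u₂

end Curves

/-! ### Finsler manifolds -/

theorem hessian_const_smul {E : Type*} [NormedAddCommGroup E] [NormedSpace ℝ E] (c : ℝ)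
    (f : E → ℝ) (z u₁ u₂ : E) :
    fderiv ℝ (fderiv ℝ (c • f)) z u₁ u₂ = c * fderiv ℝ (fderiv ℝ f) z u₁ u₂ := by
  have h2 : fderiv ℝ (c • fderiv ℝ f) = c • fderiv ℝ (fderiv ℝ f) :=
    fderiv_const_smul_field (𝕜 := ℝ) (E := E) (F := E →L[ℝ] ℝ) (R := ℝ) c
  rw [fderiv_const_smul_field, h2]
  rfl

section Finsler

variable {E M : Type*} [NormedAddCommGroup E] [NormedSpace ℝ E] [TopologicalSpace M]
  [ChartedSpace E M]

variable (E M) in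
/-- A (not necessarily reversible) Finsler metric on a smooth manifold `M` modelled on `E`. -/
structure FinslerMetric [IsManifold 𝓘(ℝ, E) ∞ M] where
  toFun : (x : M) → TangentSpace 𝓘(ℝ, E) x → ℝ
  nonneg : ∀ x v, 0 ≤ toFun x v
  smooth : ContMDiffOn 𝓘(ℝ, E).tangent 𝓘(ℝ, ℝ) ∞
    (fun v : TangentBundle 𝓘(ℝ, E) M => toFun v.proj v.snd) {v | v.snd ≠ 0}
  homogeneous : ∀ (x : M) (c : ℝ), 0 < c → ∀ v, toFun x (c • v) = c * toFun x v
  posDef : ∀ (x : M) (v u : TangentSpace 𝓘(ℝ, E) x), v ≠ 0 → u ≠ 0 →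
    0 < vertHessian 𝓘(ℝ, E) (fun x v => toFun x v ^ 2) x v u u

variable [IsManifold 𝓘(ℝ, E) ∞ M]

instance : CoeFun (FinslerMetric E M) (fun _ => (x : M) → TangentSpace 𝓘(ℝ, E) x → ℝ) :=
  ⟨FinslerMetric.toFun⟩

/-- The Finslerian length of the restriction of a curve to `[a, b]`. -/
def FinslerMetric.length (F : FinslerMetric E M) (σ : ℝ → M) (a b : ℝ) : ℝ≥0∞ :=
  ∫⁻ s in Icc a b, ENNReal.ofReal (F (σ s) (rightVelocity 𝓘(ℝ, E) σ s))

/-- The (in general non-symmetric) Finsler distance: the infimum of the lengths of the piecewise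
smooth curves from `x` to `y`. -/
def FinslerMetric.dist (F : FinslerMetric E M) (x y : M) : ℝ≥0∞ :=
  sInf {ℓ : ℝ≥0∞ | ∃ (a b : ℝ) (σ : ℝ → M), a < b ∧
    PiecewiseSmoothOn 𝓘(ℝ, E) σ (Icc a b) ∧ σ a = x ∧ σ b = y ∧ ℓ = F.length σ a b}

def FinslerMetric.IsForwardCauchySeq (F : FinslerMetric E M) (x : ℕ → M) : Prop :=
  ∀ ε : ℝ, 0 < ε → ∃ ν : ℕ, ∀ j k : ℕ, ν ≤ j → j < k → F.dist (x j) (x k) < ENNReal.ofReal ε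

def FinslerMetric.IsBackwardCauchySeq (F : FinslerMetric E M) (x : ℕ → M) : Prop :=
  ∀ ε : ℝ, 0 < ε → ∃ ν : ℕ, ∀ j k : ℕ, ν ≤ j → j < k → F.dist (x k) (x j) < ENNReal.ofReal ε

def FinslerMetric.IsForwardComplete (F : FinslerMetric E M) : Prop :=
  ∀ x : ℕ → M, F.IsForwardCauchySeq x → ∃ x₀ : M, Tendsto x atTop (𝓝 x₀)

def FinslerMetric.IsBackwardComplete (F : FinslerMetric E M) : Prop :=
  ∀ x : ℕ → M, F.IsBackwardCauchySeq x → ∃ x₀ : M, Tendsto x atTop (𝓝 x₀)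

/-- The optical Finsler metric `F / √Λ`. -/
def FinslerMetric.optical (F : FinslerMetric E M) (Λ : M → ℝ) (hΛ : ContMDiff 𝓘(ℝ, E) 𝓘(ℝ, ℝ) ∞ Λ)
    (hpos : ∀ x, 0 < Λ x) : FinslerMetric E M where
  toFun x v := F x v / √(Λ x)
  nonneg x v := div_nonneg (F.nonneg x v) (Real.sqrt_nonneg _)
  smooth := by
    have h1 : ContMDiff 𝓘(ℝ, E) 𝓘(ℝ, ℝ) ∞ (fun x => (√(Λ x))⁻¹) := by
      intro x
      have h2 : ContDiffAt ℝ ∞ (fun y : ℝ => (√y)⁻¹) (Λ x) :=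
        (Real.contDiffAt_sqrt (hpos x).ne').inv (Real.sqrt_pos.2 (hpos x)).ne'
      exact h2.contMDiffAt.comp x (hΛ x)
    have h3 : ContMDiff 𝓘(ℝ, E).tangent 𝓘(ℝ, ℝ) ∞
        (fun v : TangentBundle 𝓘(ℝ, E) M => (√(Λ v.proj))⁻¹) :=
      h1.comp (Bundle.contMDiff_proj (TangentSpace 𝓘(ℝ, E)))
    exact (F.smooth.mul h3.contMDiffOn).congr fun v _ => div_eq_mul_inv _ _
  homogeneous x c hc v := by rw [F.homogeneous x c hc v, mul_div_assoc]
  posDef x v u hv hu := by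
    have h := F.posDef x v u hv hu
    have key : vertHessian 𝓘(ℝ, E) (fun x v => (F x v / √(Λ x)) ^ 2) x v u u
        = (Λ x)⁻¹ * vertHessian 𝓘(ℝ, E) (fun x v => F x v ^ 2) x v u u := by
      have e1 : (fun y : E => (F x y / √(Λ x)) ^ 2) = (Λ x)⁻¹ • (fun y : E => F x y ^ 2) := by
        funext y
        simp only [Pi.smul_apply, smul_eq_mul, div_pow, Real.sq_sqrt (hpos x).le]
        rw [div_eq_inv_mul]
      have e2 : fderiv ℝ (fderiv ℝ (fun y : E => (F x y / √(Λ x)) ^ 2)) (v : E) (u : E) (u : E)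
          = (Λ x)⁻¹ * fderiv ℝ (fderiv ℝ (fun y : E => F x y ^ 2)) (v : E) (u : E) (u : E) := by
        rw [e1]
        exact hessian_const_smul _ _ _ _ _
      change (1 / 2 : ℝ) * _ = (Λ x)⁻¹ * ((1 / 2 : ℝ) * _)
      rw [mul_left_comm]
      exact congrArg _ e2
    rw [key]
    exact mul_pos (inv_pos.2 (hpos x)) h

end Finsler

/-! ### Causality of a Finsler function with a distinguished vector field

In this section `L` is a function on the tangent bundle of `N`, with vertical Hessian `g` defined
away from the line bundle spanned by a nowhere vanishing vector field `T`. -/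

section Causality

variable {E H N : Type*} [NormedAddCommGroup E] [NormedSpace ℝ E] [TopologicalSpace H]
  (I : ModelWithCorners ℝ E H) [TopologicalSpace N] [ChartedSpace H N]
  (L : (p : N) → TangentSpace I p → ℝ) (T : (p : N) → TangentSpace I p)

/-- Causal vectors: the non-zero multiples of `T`, and the vectors `w` off the line of `T` with
`g_w(w, w) ≤ 0`. -/
def IsCausalVec (p : N) (w : TangentSpace I p) : Prop :=
  (w ∈ Submodule.span ℝ {T p} ∧ w ≠ 0) ∨
    (w ∉ Submodule.span ℝ {T p} ∧ vertHessian I L p w w w ≤ 0)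

/-- Future-pointing causal vectors: causal vectors that are either a positive multiple of `T`, or
off the line of `T` with `g_w(w, T) < 0`. -/
def IsFutureCausalVec (p : N) (w : TangentSpace I p) : Prop :=
  IsCausalVec I L T p w ∧
    ((∃ c : ℝ, 0 < c ∧ w = c • T p) ∨
      (w ∉ Submodule.span ℝ {T p} ∧ vertHessian I L p w w (T p) < 0))

/-- The open interval of reals with (possibly infinite) end points `a` and `b`. -/
def openInterval (a b : EReal) : Set ℝ := {s : ℝ | a < (s : EReal) ∧ (s : EReal) < b}

/-- `γ` restricted to `(a, b)` is a continuous piecewise smooth future-pointing causal curve. -/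
def IsFutureCausalCurve (γ : ℝ → N) (a b : EReal) : Prop :=
  PiecewiseSmoothOn I γ (openInterval a b) ∧
    ∀ s ∈ openInterval a b,
      IsFutureCausalVec I L T (γ s) (rightVelocity I γ s) ∧
        IsFutureCausalVec I L T (γ s) (leftVelocity I γ s)

/-- `γ` has a limit as its parameter increases to `b ∈ (-∞, +∞]`. -/
def FutureExtendible (γ : ℝ → N) (b : EReal) : Prop :=
  ∃ p : N, Tendsto γ (comap ((↑) : ℝ → EReal) (𝓝[<] b)) (𝓝 p)

/-- `γ` has a limit as its parameter decreases to `a ∈ [-∞, +∞)`. -/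
def PastExtendible (γ : ℝ → N) (a : EReal) : Prop :=
  ∃ p : N, Tendsto γ (comap ((↑) : ℝ → EReal) (𝓝[>] a)) (𝓝 p)

variable (E) in
/-- `S` is a topological hypersurface: near each of its points, a chart of `N` with values in the
model vector space `E` flattens `S` to a hyperplane. -/
def IsTopologicalHypersurface (S : Set N) : Prop :=
  ∀ p ∈ S, ∃ (φ : OpenPartialHomeomorph N E) (ℓ : E →L[ℝ] ℝ), p ∈ φ.source ∧ ℓ ≠ 0 ∧
    ∀ q ∈ φ.source, q ∈ S ↔ ℓ (φ q) = 0

/-- `S` is a Cauchy hypersurface: a topological hypersurface that is met exactly once by every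
inextensible future-pointing causal curve. -/
def IsCauchyHypersurface (S : Set N) : Prop :=
  IsTopologicalHypersurface E S ∧
    ∀ (a b : EReal) (γ : ℝ → N), a < b → IsFutureCausalCurve I L T γ a b →
      ¬ FutureExtendible γ b → ¬ PastExtendible γ a →
        ∃! s : ℝ, s ∈ openInterval a b ∧ γ s ∈ S

end Causality

/-! ### Standard static Finsler spacetimes -/

section Static

variable {E M : Type*} [NormedAddCommGroup E] [NormedSpace ℝ E] [TopologicalSpace M]
  [ChartedSpace E M] [IsManifold 𝓘(ℝ, E) ∞ M]

/-- The Finsler function `L(τ, v) = -Λ τ² + F(v)²` on `ℝ × M`. -/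
def staticL (F : FinslerMetric E M) (Λ : M → ℝ) (p : ℝ × M)
    (w : TangentSpace (𝓘(ℝ, ℝ).prod 𝓘(ℝ, E)) p) : ℝ :=
  -Λ p.2 * (w : ℝ × E).1 ^ 2 + F p.2 (w : ℝ × E).2 ^ 2

variable (E M) in
/-- The vector field `∂ₜ` on `ℝ × M`. -/
def timeField (p : ℝ × M) : TangentSpace (𝓘(ℝ, ℝ).prod 𝓘(ℝ, E)) p :=
  ((1, 0) : ℝ × E)

variable (M) in
/-- The slice `{t} × M`. -/
def slice (t : ℝ) : Set (ℝ × M) := {t} ×ˢ univ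

end Static

end StaticFinsler

end

/-! Euler's identities for the 2-homogeneous function `L` give `g_w(w, w) = L(w)` and `g_w(w, T) =
-Λτ` off the line of `T`. Hence a vector `(τ, v)` is future-pointing causal exactly when `τ > 0` and
the optical norm of `v` is at most `τ` (`isFutureCausalVec_staticL_iff`). Causality thus becomes a
comparison of elapsed time with optical length. Along a causal curve the time grows strictly, and by
at least the optical distance covered (`IsFutureCausalCurve.lt_and_dist_le`). Conversely, if the
distance from `y` to `z` is less than `R`, some causal curve leads from `y` to `z` in time exactly
`R` (`exists_isCausalOn_of_dist_lt`).

Completeness implies Cauchy: if time were bounded above along an inextensible causal curve, the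
projections to `M` of points taken with increasing parameter would form a forward Cauchy sequence,
and the curve would have a future limit. Backward completeness likewise rules out a lower bound. So
time passes through every value, once by monotonicity.

Cauchy implies completeness: a forward Cauchy sequence has subsequences with successive distances
below `2⁻ⁿ`. If one of them diverged, a causal curve through its terms could use up only a finite
total time, approaching `t₀` from below. Prolonged to the past by returning to the first point at
unit intervals of time, it would be inextensible and would miss the slice. The backward case is the
mirror image.

No comparison of the topology of `M` with the distance is needed: `exists_tendsto_of_forall_seq`
recovers convergence of the whole sequence, or along the whole curve, from that of sufficiently many
sequences, by interlacing them. -/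

noncomputable section

namespace StaticFinsler

/-! ### Euler's identities in degree two. -/

section Homogeneous

variable {V : Type*} [NormedAddCommGroup V] [NormedSpace ℝ V]

/-- Differentiate `f (c • y) = c ^ 2 * f y` in `y` and cancel one factor `c`. Both rules used hold
for the default value of `fderiv` too, so no differentiability is required. -/
theorem fderiv_smul_of_homogeneous_two {f : V → ℝ}
    (hf : ∀ c : ℝ, 0 < c → ∀ y, f (c • y) = c ^ 2 * f y) {c : ℝ} (hc : 0 < c) (w : V) :
    fderiv ℝ f (c • w) = c • fderiv ℝ f w := by
  have h1 : fderiv ℝ (fun y => f (c • y)) w = c • fderiv ℝ f (c • w) := by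
    simpa using fderiv_comp_smul (𝕜 := ℝ) (f := f) (x := w) c
  have h2 : (fun y => f (c • y)) = (c ^ 2) • f := by
    funext y
    simp [hf c hc y]
  rw [h2, fderiv_const_smul_field] at h1
  have h3 : c • (fderiv ℝ f (c • w)) = c • (c • fderiv ℝ f w) := by
    rw [← h1, smul_smul, sq]
    rfl
  exact smul_right_injective _ hc.ne' h3

theorem hasDerivAt_smul_const_one (w : V) : HasDerivAt (fun c : ℝ => c • w) w 1 := by
  simpa using (hasDerivAt_id (1 : ℝ)).smul_const w

/-- Differentiate `f (c • w) = c ^ 2 * f w` in `c` at `c = 1`. -/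
theorem fderiv_apply_self_of_homogeneous_two {f : V → ℝ}
    (hf : ∀ c : ℝ, 0 < c → ∀ y, f (c • y) = c ^ 2 * f y) {w : V} (hd : DifferentiableAt ℝ f w) :
    fderiv ℝ f w w = 2 * f w := by
  have h1 : HasDerivAt (fun c : ℝ => f (c • w)) (fderiv ℝ f w w) 1 := by
    refine HasFDerivAt.comp_hasDerivAt (x := (1 : ℝ)) (f := fun c : ℝ => c • w) ?_
      (hasDerivAt_smul_const_one w)
    simpa using hd.hasFDerivAt
  have h2 : HasDerivAt (fun c : ℝ => c ^ 2 * f w) (2 * f w) 1 := by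
    simpa using ((hasDerivAt_pow 2 (1 : ℝ)).mul_const (f w))
  refine h1.unique (h2.congr_of_eventuallyEq ?_)
  filter_upwards [lt_mem_nhds (zero_lt_one' ℝ)] with c hc using hf c hc w

/-- Euler's identity again, now for the 1-homogeneous map `fderiv ℝ f`. -/
theorem fderiv_fderiv_apply_self_of_homogeneous_two {f : V → ℝ}
    (hf : ∀ c : ℝ, 0 < c → ∀ y, f (c • y) = c ^ 2 * f y) {w : V}
    (hd : DifferentiableAt ℝ (fderiv ℝ f) w) :
    fderiv ℝ (fderiv ℝ f) w w = fderiv ℝ f w := by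
  have h1 : HasDerivAt (fun c : ℝ => fderiv ℝ f (c • w)) (fderiv ℝ (fderiv ℝ f) w w) 1 := by
    refine HasFDerivAt.comp_hasDerivAt (x := (1 : ℝ)) (f := fun c : ℝ => c • w) ?_
      (hasDerivAt_smul_const_one w)
    simpa using hd.hasFDerivAt
  refine h1.unique ((hasDerivAt_smul_const_one (fderiv ℝ f w)).congr_of_eventuallyEq ?_)
  filter_upwards [lt_mem_nhds (zero_lt_one' ℝ)] with c hc using
    fderiv_smul_of_homogeneous_two hf hc w

end Homogeneous

/-! ### The causal cone of a static spacetime, and continuity of Finsler metrics. -/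

section TimeField

variable {E M : Type*} [NormedAddCommGroup E] [NormedSpace ℝ E] [TopologicalSpace M]
  [ChartedSpace E M]

theorem mem_span_timeField (p : ℝ × M) (w : TangentSpace (𝓘(ℝ, ℝ).prod 𝓘(ℝ, E)) p) :
    w ∈ Submodule.span ℝ {timeField E M p} ↔ (w : ℝ × E).2 = 0 := by
  rw [Submodule.mem_span_singleton]
  constructor
  · rintro ⟨c, rfl⟩
    change c • (0 : E) = 0
    simp
  · intro h
    refine ⟨(w : ℝ × E).1, ?_⟩
    change ((w : ℝ × E).1 • ((1, 0) : ℝ × E)) = w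
    refine Prod.ext ?_ ?_
    · simp
    · simpa using h.symm

end TimeField

section Finsler

variable {E M : Type*} [NormedAddCommGroup E] [NormedSpace ℝ E] [TopologicalSpace M]
  [ChartedSpace E M] [IsManifold 𝓘(ℝ, E) ∞ M]

theorem FinslerMetric.zero (F : FinslerMetric E M) (x : M) : F x 0 = 0 := by
  have h := F.homogeneous x 2 two_pos 0
  rw [smul_zero] at h
  linarith

/-- The inclusion of a fibre in the tangent bundle is smooth. -/
theorem contMDiff_totalSpaceMk_tangent (x : M) :
    ContMDiff 𝓘(ℝ, E) 𝓘(ℝ, E).tangent ∞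
      (fun v : E => (⟨x, v⟩ : TangentBundle 𝓘(ℝ, E) M)) := by
  intro v
  rw [Bundle.contMDiffAt_totalSpace]
  refine ⟨contMDiffAt_const, ?_⟩
  set e := trivializationAt E (TangentSpace 𝓘(ℝ, E)) x
  have hx : x ∈ e.baseSet := FiberBundle.mem_baseSet_trivializationAt' x
  let A : E →L[ℝ] E := e.continuousLinearMapAt ℝ x
  have h : (fun y : E => (e (⟨x, y⟩ : TangentBundle 𝓘(ℝ, E) M)).2) = A := by
    funext y
    exact (congrFun (e.coe_linearMapAt_of_mem (R := ℝ) hx) y).symm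
  change ContMDiffAt 𝓘(ℝ, E) 𝓘(ℝ, E) ∞
    (fun y : E => (e (⟨x, y⟩ : TangentBundle 𝓘(ℝ, E) M)).2) v
  rw [h]
  exact A.contDiff.contMDiff v

theorem FinslerMetric.contDiffAt_fibre (F : FinslerMetric E M) (x : M) {v : E} (hv : v ≠ 0) :
    ContDiffAt ℝ ∞ (fun y : E => F x y) v := by
  have h1 : ContMDiffOn 𝓘(ℝ, E) 𝓘(ℝ, ℝ) ∞ (fun y : E => F x y) {y | y ≠ 0} :=
    F.smooth.comp (contMDiff_totalSpaceMk_tangent x).contMDiffOn fun y hy => hy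
  exact ((contMDiffOn_iff_contDiffOn.1 h1) v hv).contDiffAt (isOpen_ne.mem_nhds hv)

variable (F : FinslerMetric E M) (Λ : M → ℝ)

theorem staticL_homogeneous (p : ℝ × M) (c : ℝ) (hc : 0 < c) (w : ℝ × E) :
    staticL F Λ p (c • w : ℝ × E) = c ^ 2 * staticL F Λ p w := by
  have h : F p.2 (c • w : ℝ × E).2 = c * F p.2 w.2 := F.homogeneous p.2 c hc w.2
  unfold staticL
  rw [h, Prod.smul_fst, smul_eq_mul]
  ring

theorem contDiffAt_staticL (p : ℝ × M) {w : ℝ × E} (hw : w.2 ≠ 0) :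
    ContDiffAt ℝ ∞ (fun y : ℝ × E => staticL F Λ p y) w := by
  have h1 : ContDiffAt ℝ ∞ (fun y : ℝ × E => F p.2 y.2) w :=
    (F.contDiffAt_fibre p.2 hw).comp w contDiffAt_snd
  have h2 : ContDiffAt ℝ ∞ (fun y : ℝ × E => -Λ p.2 * y.1 ^ 2) w :=
    contDiffAt_const.mul (contDiffAt_fst.pow 2)
  exact h2.add (h1.pow 2)

theorem fderiv_staticL_timeField (p : ℝ × M) {w : ℝ × E} (hw : w.2 ≠ 0) :
    fderiv ℝ (fun y : ℝ × E => staticL F Λ p y) w ((1, 0) : ℝ × E) = -2 * Λ p.2 * w.1 := by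
  have hd : DifferentiableAt ℝ (fun y : ℝ × E => staticL F Λ p y) w :=
    (contDiffAt_staticL F Λ p hw).differentiableAt (by simp)
  have hl : HasDerivAt (fun c : ℝ => w + c • ((1, 0) : ℝ × E)) ((1, 0) : ℝ × E) 0 := by
    simpa using ((hasDerivAt_id (0 : ℝ)).smul_const ((1, 0) : ℝ × E)).const_add w
  have h1 : HasDerivAt (fun c : ℝ => staticL F Λ p (w + c • ((1, 0) : ℝ × E) : ℝ × E))
      (fderiv ℝ (fun y : ℝ × E => staticL F Λ p y) w ((1, 0) : ℝ × E)) 0 := by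
    refine HasFDerivAt.comp_hasDerivAt (x := (0 : ℝ)) (f := fun c : ℝ => w + c • ((1, 0) : ℝ × E))
      (l := fun y : ℝ × E => staticL F Λ p y) ?_ hl
    simpa using hd.hasFDerivAt
  have h2 : HasDerivAt (fun c : ℝ => -Λ p.2 * (w.1 + c) ^ 2 + F p.2 w.2 ^ 2)
      (-2 * Λ p.2 * w.1) 0 := by
    have h3 : HasDerivAt (fun c : ℝ => w.1 + c) 1 0 := (hasDerivAt_id (0 : ℝ)).const_add w.1
    have := ((h3.pow 2).const_mul (-Λ p.2)).add_const (F p.2 w.2 ^ 2)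
    refine this.congr_deriv ?_
    norm_num
    ring
  refine h1.unique (h2.congr_of_eventuallyEq (Eventually.of_forall fun c => ?_))
  have h4 : w + c • ((1, 0) : ℝ × E) = (w.1 + c, w.2) := by ext <;> simp
  exact congrArg (fun y : ℝ × E => staticL F Λ p y) h4

variable {F Λ} in
/-- Future-pointing causal vectors of a standard static spacetime. -/
theorem isFutureCausalVec_staticL_iff (hpos : ∀ x, 0 < Λ x) (p : ℝ × M)
    (w : TangentSpace (𝓘(ℝ, ℝ).prod 𝓘(ℝ, E)) p) :
    IsFutureCausalVec (𝓘(ℝ, ℝ).prod 𝓘(ℝ, E)) (staticL F Λ) (timeField E M) p w ↔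
      0 < (w : ℝ × E).1 ∧ F p.2 (w : ℝ × E).2 / √(Λ p.2) ≤ (w : ℝ × E).1 := by
  unfold IsFutureCausalVec IsCausalVec
  rw [mem_span_timeField]
  by_cases hw : (w : ℝ × E).2 = 0
  · have h0 : F p.2 (w : ℝ × E).2 = 0 := by rw [hw]; exact F.zero p.2
    simp only [hw, true_and, not_true_eq_false, false_and, or_false]
    constructor
    · rintro ⟨-, c, hc, h⟩
      have : (w : ℝ × E).1 = c := by
        rw [h]
        change c • (1 : ℝ) = c
        simp
      rw [this, ← hw, h0]
      simp [hc, hc.le]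
    · rintro ⟨h, -⟩
      refine ⟨fun h1 => ?_, (w : ℝ × E).1, h, ?_⟩
      · rw [h1] at h
        exact lt_irrefl (0 : ℝ) h
      · refine Prod.ext ?_ ?_
        · change (w : ℝ × E).1 = (w : ℝ × E).1 • (1 : ℝ)
          simp
        · change (w : ℝ × E).2 = (w : ℝ × E).1 • (0 : E)
          rw [hw, smul_zero]
  · have hsm := contDiffAt_staticL F Λ p hw
    have hd1 : DifferentiableAt ℝ (fun y : ℝ × E => staticL F Λ p y) w :=
      hsm.differentiableAt (by simp)
    have hd2 : DifferentiableAt ℝ (fderiv ℝ (fun y : ℝ × E => staticL F Λ p y)) w :=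
      (hsm.fderiv_right (m := 1) (by norm_cast)).differentiableAt (by simp)
    -- This reads `g_w(w, ·) = ½ dL_w`; both conditions on `w` then involve only the first
    -- derivative of `L`.
    have e := fderiv_fderiv_apply_self_of_homogeneous_two (staticL_homogeneous F Λ p) hd2
    have e1 : vertHessian (𝓘(ℝ, ℝ).prod 𝓘(ℝ, E)) (staticL F Λ) p w w w = staticL F Λ p w := by
      change (1 / 2 : ℝ) * fderiv ℝ (fderiv ℝ (fun y : ℝ × E => staticL F Λ p y)) w w w = _
      rw [e, fderiv_apply_self_of_homogeneous_two (staticL_homogeneous F Λ p) hd1]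
      ring
    have e2 : vertHessian (𝓘(ℝ, ℝ).prod 𝓘(ℝ, E)) (staticL F Λ) p w w (timeField E M p)
        = -Λ p.2 * (w : ℝ × E).1 := by
      change (1 / 2 : ℝ) * fderiv ℝ (fderiv ℝ (fun y : ℝ × E => staticL F Λ p y)) w w
        ((1, 0) : ℝ × E) = _
      rw [e, fderiv_staticL_timeField F Λ p hw]
      ring
    have hns : ¬ ∃ c : ℝ, 0 < c ∧ w = c • timeField E M p := by
      rintro ⟨c, -, h⟩
      exact hw ((mem_span_timeField p w).1 (h ▸ Submodule.smul_mem _ _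
        (Submodule.mem_span_singleton_self _)))
    simp only [hw, hns, false_and, not_false_eq_true, true_and, false_or, e1, e2]
    have hΛ := hpos p.2
    have hs : 0 < √(Λ p.2) := Real.sqrt_pos.2 hΛ
    have hsq : √(Λ p.2) ^ 2 = Λ p.2 := Real.sq_sqrt hΛ.le
    have hF := F.nonneg p.2 (w : ℝ × E).2
    change -Λ p.2 * (w : ℝ × E).1 ^ 2 + F p.2 (w : ℝ × E).2 ^ 2 ≤ 0 ∧ _ ↔ _
    have ht : -Λ p.2 * (w : ℝ × E).1 < 0 ↔ 0 < (w : ℝ × E).1 := by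
      rw [neg_mul, neg_lt_zero]
      exact mul_pos_iff_of_pos_left hΛ
    rw [ht, and_comm]
    refine and_congr_right fun hτ => ?_
    rw [div_le_iff₀ hs, ← pow_le_pow_iff_left₀ hF (by positivity) two_ne_zero, mul_pow, hsq]
    constructor <;> intro h <;> linarith

/-- A Finsler metric is continuous on the tangent bundle, including the zero section. -/
theorem FinslerMetric.continuous [FiniteDimensional ℝ E] (F : FinslerMetric E M) :
    Continuous (fun v : TangentBundle 𝓘(ℝ, E) M => F v.proj v.snd) := by
  rw [continuous_iff_continuousAt]
  intro v₀
  set x₀ := v₀.proj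
  set e := trivializationAt E (TangentSpace 𝓘(ℝ, E)) x₀
  have hx₀ : x₀ ∈ e.baseSet := FiberBundle.mem_baseSet_trivializationAt' x₀
  let G : M × E → ℝ := fun z => F z.1 (e.symmL ℝ z.1 z.2)
  have hmk : ∀ z ∈ e.baseSet ×ˢ (univ : Set E),
      (⟨z.1, e.symmL ℝ z.1 z.2⟩ : TangentBundle 𝓘(ℝ, E) M) =
        e.toOpenPartialHomeomorph.symm z := by
    intro z hz
    rw [e.symmL_apply hz.1]
    exact e.mk_symm hz.1 z.2
  have hcont : ContinuousOn (fun z : M × E =>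
      (⟨z.1, e.symmL ℝ z.1 z.2⟩ : TangentBundle 𝓘(ℝ, E) M)) (e.baseSet ×ˢ univ) := by
    refine ContinuousOn.congr ?_ hmk
    have := e.toOpenPartialHomeomorph.continuousOn_symm
    rwa [e.target_eq] at this
  have hG : ContinuousOn G (e.baseSet ×ˢ {u | u ≠ 0}) := by
    refine F.smooth.continuousOn.comp (hcont.mono (prod_mono_right (subset_univ _))) ?_
    rintro ⟨y, u⟩ ⟨hy, hu⟩ h0
    refine hu ?_
    have := e.continuousLinearMapAt_symmL (R := ℝ) hy u
    change e.symmL ℝ y u = 0 at h0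
    rw [h0, map_zero] at this
    exact this.symm
  have hopen : IsOpen (e.baseSet ×ˢ {u : E | u ≠ 0}) := e.open_baseSet.prod isOpen_ne
  have hGat : ∀ u : E, ContinuousAt G (x₀, u) := by
    intro u
    rcases eq_or_ne u 0 with rfl | hu
    -- At the zero vector smoothness says nothing. Compactness bounds `G` on the unit sphere
    -- uniformly for base points near `x₀`, and homogeneity turns this into `G z ≤ C * ‖z.2‖`.
    · have hbd : ∀ᶠ y in 𝓝 x₀, ∀ k ∈ Metric.sphere (0 : E) 1, G (y, k) < sSup (G '' ({x₀} ×ˢ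
          Metric.sphere (0 : E) 1)) + 1 := by
        have hsub : {x₀} ×ˢ Metric.sphere (0 : E) 1 ⊆ e.baseSet ×ˢ {u : E | u ≠ 0} := by
          rintro ⟨y, k⟩ ⟨hy, hk⟩
          refine ⟨(mem_singleton_iff.1 hy) ▸ hx₀, fun h => ?_⟩
          have hk1 : ‖k‖ = 1 := mem_sphere_zero_iff_norm.1 hk
          have hk0 : k = 0 := h
          rw [hk0, norm_zero] at hk1
          exact zero_ne_one hk1
        have hcpt : IsCompact (G '' ({x₀} ×ˢ Metric.sphere (0 : E) 1)) :=
          (isCompact_singleton.prod (isCompact_sphere 0 1)).image_of_continuousOn (hG.mono hsub)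
        refine (isCompact_sphere (0 : E) 1).eventually_forall_of_forall_eventually
          (P := fun y k => G (y, k) < _) fun k hk => ?_
        have hk' : (x₀, k) ∈ {x₀} ×ˢ Metric.sphere (0 : E) 1 := ⟨rfl, hk⟩
        refine (hG.continuousAt (hopen.mem_nhds (hsub hk'))).eventually_lt_const ?_
        exact (le_csSup hcpt.bddAbove (mem_image_of_mem G hk')).trans_lt (lt_add_one _)
      set C := sSup (G '' ({x₀} ×ˢ Metric.sphere (0 : E) 1)) + 1
      have h0 : G (x₀, 0) = 0 := by
        change F x₀ (e.symmL ℝ x₀ 0) = 0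
        rw [map_zero, F.zero]
      have hle : ∀ᶠ z : M × E in 𝓝 (x₀, 0), G z ≤ C * ‖z.2‖ := by
        have : ∀ᶠ z : M × E in 𝓝 (x₀, (0 : E)), ∀ k ∈ Metric.sphere (0 : E) 1, G (z.1, k) < C :=
          (continuous_fst.tendsto (x₀, (0 : E))).eventually hbd
        filter_upwards [this] with z hz
        rcases eq_or_ne z.2 0 with h | h
        · change F z.1 (e.symmL ℝ z.1 z.2) ≤ _
          rw [h, map_zero, F.zero, norm_zero, mul_zero]
        · have hn : 0 < ‖z.2‖ := norm_pos_iff.2 h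
          have h1 := hz (‖z.2‖⁻¹ • z.2) (by simp [norm_smul, hn.ne'])
          have h2 : G z = ‖z.2‖ * G (z.1, ‖z.2‖⁻¹ • z.2) := by
            have h3 := F.homogeneous z.1 ‖z.2‖ hn (e.symmL ℝ z.1 (‖z.2‖⁻¹ • z.2))
            rw [← map_smul, smul_inv_smul₀ hn.ne'] at h3
            exact h3
          rw [h2, mul_comm]
          exact mul_le_mul_of_nonneg_right h1.le hn.le
      rw [ContinuousAt, h0]
      refine squeeze_zero' (Eventually.of_forall fun z => F.nonneg _ _) hle ?_
      have : Continuous fun z : M × E => C * ‖z.2‖ := by fun_prop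
      simpa using this.tendsto (x₀, (0 : E))
    · exact hG.continuousAt (hopen.mem_nhds ⟨hx₀, hu⟩)
  have hsrc : v₀ ∈ e.source := e.mem_source.2 hx₀
  have hev : (fun v : TangentBundle 𝓘(ℝ, E) M => F v.proj v.snd) =ᶠ[𝓝 v₀] fun v => G (e v) := by
    filter_upwards [e.open_source.mem_nhds hsrc] with v hv
    have h1 : (e v).1 = v.proj := e.coe_fst hv
    have h2 : e.toOpenPartialHomeomorph.symm (e v) = v := e.toOpenPartialHomeomorph.left_inv hv
    rw [← hmk (e v) ⟨h1 ▸ e.mem_source.1 hv, mem_univ _⟩] at h2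
    exact (congrArg (fun v : TangentBundle 𝓘(ℝ, E) M => F v.proj v.snd) h2).symm
  refine ContinuousAt.congr ?_ hev.symm
  have hev₀ : e v₀ = (x₀, (e v₀).2) := Prod.ext (e.coe_fst hsrc) rfl
  exact ContinuousAt.comp (f := e) (hev₀ ▸ hGat _) (e.continuousAt hsrc)

end Finsler

/-! ### Convergence from convergence along sparse sequences. -/

section Filters

/-- A function converges along a countably generated filter as soon as it converges along all
sequences whose consecutive terms satisfy given relations, each of which holds for all terms that
are far enough and sufficiently far apart. -/
theorem exists_tendsto_of_forall_seq {α X : Type*} [TopologicalSpace X] [T2Space X]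
    {l : Filter α} [l.NeBot] [l.IsCountablyGenerated] {f : α → X} {R : ℕ → α → α → Prop}
    (hR : ∀ n, ∀ᶠ a in l, ∀ᶠ b in l, R n a b)
    (h : ∀ u : ℕ → α, Tendsto u atTop l → (∀ n, R n (u n) (u (n + 1))) →
      ∃ x, Tendsto (f ∘ u) atTop (𝓝 x)) :
    ∃ x, Tendsto f l (𝓝 x) := by
  obtain ⟨B, hB⟩ := l.exists_antitone_basis
  have key : ∀ A : ℕ → α → Prop, (∀ n, ∃ᶠ a in l, A n a) →
      ∃ u : ℕ → α, Tendsto u atTop l ∧ (∀ n, R n (u n) (u (n + 1))) ∧ ∀ n, A n (u n) := by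
    intro A hA
    -- The last clause keeps the recursion alive: almost every candidate for the next term is
    -- related to `a`.
    let Q : ℕ → α → Prop := fun n a => A n a ∧ a ∈ B n ∧ ∀ᶠ b in l, R n a b
    have hstep : ∀ n a, Q n a → ∃ b, Q (n + 1) b ∧ R n a b := by
      intro n a ha
      obtain ⟨b, h1, h2, h3, h4⟩ := ((hA (n + 1)).and_eventually
        ((eventually_mem_set.2 (hB.mem (n + 1))).and ((hR (n + 1)).and ha.2.2))).exists
      exact ⟨b, ⟨h1, h2, h3⟩, h4⟩
    have h0 : ∃ a, Q 0 a := by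
      obtain ⟨a, h1, h2, h3⟩ := ((hA 0).and_eventually
        ((eventually_mem_set.2 (hB.mem 0)).and (hR 0))).exists
      exact ⟨a, h1, h2, h3⟩
    choose! g hg using hstep
    obtain ⟨a₀, ha₀⟩ := h0
    let u : ℕ → α := fun n => Nat.rec a₀ (fun k a => g k a) n
    have hu : ∀ n, Q n (u n) := by
      intro n
      induction n with
      | zero => exact ha₀
      | succ k ih => exact (hg k _ ih).1
    exact ⟨u, hB.tendsto fun n => (hu n).2.1, fun n => (hg n _ (hu n)).2, fun n => (hu n).1⟩
  obtain ⟨u₀, hu₀, hu₀', -⟩ := key (fun _ _ => True) fun n => Eventually.frequently (by simp)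
  obtain ⟨p, hp⟩ := h u₀ hu₀ hu₀'
  by_contra hcon
  have hnp : ¬ Tendsto f l (𝓝 p) := fun hc => hcon ⟨p, hc⟩
  rw [tendsto_iff_forall_eventually_mem] at hnp
  push Not at hnp
  obtain ⟨W, hW, hfr⟩ := hnp
  -- Interlacing: the even terms, taken from `u₀`, force the limit to be `p`, while the odd terms
  -- have values outside the neighbourhood `W` of `p`.
  let A : ℕ → α → Prop := fun n a => if Even n then ∃ k, n ≤ k ∧ a = u₀ k else f a ∉ W
  have hA : ∀ n, ∃ᶠ a in l, A n a := by
    intro n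
    by_cases hn : Even n
    · simp only [A, hn, if_true]
      refine hu₀.frequently (p := fun a => ∃ k, n ≤ k ∧ a = u₀ k) (Eventually.frequently ?_)
      filter_upwards [eventually_ge_atTop n] with k hk using ⟨k, hk, rfl⟩
    · simpa only [A, hn, if_false] using hfr
  obtain ⟨u, hu, hu', huA⟩ := key A hA
  obtain ⟨q, hq⟩ := h u hu hu'
  have heven : Tendsto (fun n : ℕ => 2 * n) atTop atTop :=
    tendsto_atTop_mono (fun n => by simp only [id]; omega) tendsto_id
  have hodd : Tendsto (fun n : ℕ => 2 * n + 1) atTop atTop :=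
    tendsto_atTop_mono (fun n => by simp only [id]; omega) tendsto_id
  have hk : ∀ n, ∃ k, 2 * n ≤ k ∧ u (2 * n) = u₀ k := fun n => by
    simpa only [A, even_two_mul, if_true] using huA (2 * n)
  choose k hkn hku using hk
  have hkt : Tendsto k atTop atTop := tendsto_atTop_mono hkn heven
  have hpq : q = p := by
    refine tendsto_nhds_unique (hq.comp heven) ((hp.comp hkt).congr fun n => ?_)
    simp [hku n]
  obtain ⟨n, hn⟩ := ((hq.comp hodd).eventually (hpq ▸ eventually_mem_set.2 hW)).exists
  have := huA (2 * n + 1)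
  simp only [A, Nat.not_even_bit1, if_false] at this
  exact this hn

end Filters

/-! ### Piecewise smooth curves and one-sided velocities. -/

section Curves

variable {E H N : Type*} [NormedAddCommGroup E] [NormedSpace ℝ E] [TopologicalSpace H]
  {I : ModelWithCorners ℝ E H} [TopologicalSpace N] [ChartedSpace H N]

/-- A curve that is smooth on both sides of each parameter is piecewise smooth. -/
theorem piecewiseSmoothOn_of_forall_sides {γ : ℝ → N}
    (hr : ∀ s, ∃ U ∈ 𝓝 s, ContMDiffOn 𝓘(ℝ, ℝ) I ∞ γ (Ici s ∩ U))
    (hl : ∀ s, ∃ U ∈ 𝓝 s, ContMDiffOn 𝓘(ℝ, ℝ) I ∞ γ (Iic s ∩ U)) (J : Set ℝ) :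
    PiecewiseSmoothOn I γ J := by
  have hr' : ∀ s, ContMDiffWithinAt 𝓘(ℝ, ℝ) I ∞ γ (Ici s) s := by
    intro s
    obtain ⟨U, hU, h⟩ := hr s
    exact (h s ⟨self_mem_Ici, mem_of_mem_nhds hU⟩).mono_of_mem_nhdsWithin
      (inter_mem self_mem_nhdsWithin (mem_nhdsWithin_of_mem_nhds hU))
  have hl' : ∀ s, ContMDiffWithinAt 𝓘(ℝ, ℝ) I ∞ γ (Iic s) s := by
    intro s
    obtain ⟨U, hU, h⟩ := hl s
    exact (h s ⟨self_mem_Iic, mem_of_mem_nhds hU⟩).mono_of_mem_nhdsWithin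
      (inter_mem self_mem_nhdsWithin (mem_nhdsWithin_of_mem_nhds hU))
  refine ⟨fun s _ => (continuousAt_iff_continuous_left_right.2
    ⟨(hl' s).continuousWithinAt, (hr' s).continuousWithinAt⟩).continuousWithinAt,
    {s | ¬ ContMDiffAt 𝓘(ℝ, ℝ) I ∞ γ s}, ?_, ?_⟩
  -- The break points are the points of non-smoothness. One-sided smoothness near `s` leaves at most
  -- `s` itself as a break point nearby, so compactness gives finiteness.
  · intro c d _
    refine (isCompact_Icc (a := c) (b := d)).induction_on
      (p := fun K => ({s | ¬ ContMDiffAt 𝓘(ℝ, ℝ) I ∞ γ s} ∩ K).Finite) (by simp)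
      (fun s t hst ht => ht.subset (inter_subset_inter_right _ hst))
      (fun s t hs ht => by rw [inter_union_distrib_left]; exact hs.union ht) ?_
    intro s _
    obtain ⟨U, hU, hU'⟩ := hr s
    obtain ⟨V, hV, hV'⟩ := hl s
    refine ⟨interior (U ∩ V), mem_nhdsWithin_of_mem_nhds
      (interior_mem_nhds.2 (inter_mem hU hV)), (finite_singleton s).subset ?_⟩
    rintro r ⟨hr1, hr2⟩
    have hrn : U ∩ V ∈ 𝓝 r := mem_interior_iff_mem_nhds.1 hr2
    by_contra hne
    rcases lt_or_gt_of_ne (show r ≠ s from hne) with h | h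
    · exact hr1 ((hV' r ⟨h.le, (mem_of_mem_nhds hrn).2⟩).contMDiffAt
        (inter_mem (Iic_mem_nhds h) (mem_of_superset hrn inter_subset_right)))
    · exact hr1 ((hU' r ⟨h.le, (mem_of_mem_nhds hrn).1⟩).contMDiffAt
        (inter_mem (Ici_mem_nhds h) (mem_of_superset hrn inter_subset_left)))
  · intro c d _ _ hP s hs
    rcases eq_or_lt_of_le hs.1 with rfl | h1
    · exact (hr' c).mono Icc_subset_Ici_self
    rcases eq_or_lt_of_le hs.2 with rfl | h2
    · exact (hl' s).mono Icc_subset_Iic_self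
    · by_contra hc
      exact (disjoint_left.1 hP) (fun h => hc h.contMDiffWithinAt) ⟨h1, h2⟩

/-- The velocity within `A` does not depend on `A`, as long as it contains one side. -/
theorem mfderivWithin_eq_of_mem_nhdsWithin {γ : ℝ → N} {A S : Set ℝ} {s : ℝ}
    (h : MDifferentiableWithinAt 𝓘(ℝ, ℝ) I γ A s) (hS : UniqueDiffWithinAt ℝ S s)
    (hA : A ∈ 𝓝[S] s) :
    mfderivWithin 𝓘(ℝ, ℝ) I γ S s = mfderivWithin 𝓘(ℝ, ℝ) I γ A s :=
  (h.hasMFDerivWithinAt.mono_of_mem_nhdsWithin hA).mfderivWithin hS.uniqueMDiffWithinAt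

theorem PiecewiseSmoothOn.mono {γ : ℝ → N} {J J' : Set ℝ} (h : PiecewiseSmoothOn I γ J)
    (hJ : J' ⊆ J) : PiecewiseSmoothOn I γ J' := by
  obtain ⟨hc, P, h1, h2⟩ := h
  exact ⟨hc.mono hJ, P, fun c d hcd => h1 c d (hcd.trans hJ),
    fun c d hlt hcd => h2 c d hlt (hcd.trans hJ)⟩

theorem mfderivWithin_affine {γ : ℝ → N} {α β s : ℝ} {S : Set ℝ}
    (h : MDifferentiableWithinAt 𝓘(ℝ, ℝ) I γ S (α * s + β))
    (hS : UniqueDiffWithinAt ℝ ((fun r => α * r + β) ⁻¹' S) s) :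
    mfderivWithin 𝓘(ℝ, ℝ) I (fun r => γ (α * r + β)) ((fun r => α * r + β) ⁻¹' S) s (1 : ℝ) =
      α • mfderivWithin 𝓘(ℝ, ℝ) I γ S (α * s + β) (1 : ℝ) := by
  have h1 : HasDerivAt (fun r : ℝ => α * r + β) α s := by
    simpa using ((hasDerivAt_id s).const_mul α).add_const β
  have h2 := h.hasMFDerivWithinAt.comp s
    (h1.hasFDerivAt.hasMFDerivAt.hasMFDerivWithinAt (s := (fun r => α * r + β) ⁻¹' S)) subset_rfl
  have h3 : ∀ A : ℝ →L[ℝ] E, (A.comp (ContinuousLinearMap.toSpanSingleton ℝ α)) 1 = α • A 1 := by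
    intro A
    simp only [ContinuousLinearMap.comp_apply, ContinuousLinearMap.toSpanSingleton_apply, one_smul]
    rw [← map_smul, smul_eq_mul, mul_one]
  exact (congrArg (fun A : ℝ →L[ℝ] E => A 1) (h2.mfderivWithin hS.uniqueMDiffWithinAt)).trans (h3 _)

end Curves

section Velocity

variable {E M : Type*} [NormedAddCommGroup E] [NormedSpace ℝ E] [TopologicalSpace M]
  [ChartedSpace E M]

theorem mfderivWithin_prod_apply_one {γ : ℝ → ℝ × M} {S : Set ℝ} {s : ℝ}
    (hS : UniqueDiffWithinAt ℝ S s)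
    (h : MDifferentiableWithinAt 𝓘(ℝ, ℝ) (𝓘(ℝ, ℝ).prod 𝓘(ℝ, E)) γ S s) :
    (mfderivWithin 𝓘(ℝ, ℝ) (𝓘(ℝ, ℝ).prod 𝓘(ℝ, E)) γ S s (1 : ℝ) : ℝ × E) =
      (derivWithin (fun r => (γ r).1) S s,
        mfderivWithin 𝓘(ℝ, ℝ) 𝓘(ℝ, E) (fun r => (γ r).2) S s (1 : ℝ)) := by
  have h1 : MDifferentiableWithinAt 𝓘(ℝ, ℝ) 𝓘(ℝ, ℝ) (fun r => (γ r).1) S s :=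
    mdifferentiableAt_fst.comp_mdifferentiableWithinAt s h
  have h2 : MDifferentiableWithinAt 𝓘(ℝ, ℝ) 𝓘(ℝ, E) (fun r => (γ r).2) S s :=
    mdifferentiableAt_snd.comp_mdifferentiableWithinAt s h
  have h3 := mfderivWithin_prodMk h1 h2 hS.uniqueMDiffWithinAt
  have h4 : (mfderivWithin 𝓘(ℝ, ℝ) 𝓘(ℝ, ℝ) (fun r => (γ r).1) S s (1 : ℝ) : ℝ) =
      derivWithin (fun r => (γ r).1) S s := by
    rw [mfderivWithin_eq_fderivWithin]
    rfl
  rw [← h4]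
  exact congrArg (fun A : ℝ →L[ℝ] ℝ × E => A 1) h3

/-- The velocity of a smooth curve on a compact interval is continuous in the tangent bundle. -/
theorem continuousOn_velocity [IsManifold 𝓘(ℝ, E) ∞ M] {x : ℝ → M} {a b : ℝ} (hab : a < b)
    (hx : ContMDiffOn 𝓘(ℝ, ℝ) 𝓘(ℝ, E) ∞ x (Icc a b)) :
    ContinuousOn (fun s => (⟨x s, mfderivWithin 𝓘(ℝ, ℝ) 𝓘(ℝ, E) x (Icc a b) s (1 : ℝ)⟩ :
      TangentBundle 𝓘(ℝ, E) M)) (Icc a b) := by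
  have h1 := (hx.contMDiffOn_tangentMapWithin (m := 0) (by simp)
    (uniqueDiffOn_Icc hab).uniqueMDiffOn).continuousOn
  have h2 : Continuous (fun s : ℝ => (⟨s, (1 : ℝ)⟩ : TangentBundle 𝓘(ℝ, ℝ) ℝ)) :=
    (tangentBundleModelSpaceHomeomorph 𝓘(ℝ, ℝ)).symm.continuous.comp
      (continuous_id.prodMk continuous_const)
  exact h1.comp h2.continuousOn fun s hs => hs

end Velocity

/-! ### Construction of causal curves with prescribed elapsed time. -/

section CausalGerm

variable {E M : Type*} [NormedAddCommGroup E] [NormedSpace ℝ E] [TopologicalSpace M]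
  [ChartedSpace E M] [IsManifold 𝓘(ℝ, E) ∞ M] (F : FinslerMetric E M)

/-- The Finslerian speed of a curve at `s`, computed within the set `S`. -/
def FinslerMetric.speed (x : ℝ → M) (S : Set ℝ) (s : ℝ) : ℝ :=
  F (x s) (mfderivWithin 𝓘(ℝ, ℝ) 𝓘(ℝ, E) x S s (1 : ℝ))

theorem FinslerMetric.length_eq_lintegral_speed (x : ℝ → M) (a b : ℝ) :
    F.length x a b = ∫⁻ s in Icc a b, ENNReal.ofReal (F.speed x (Ici s) s) := rfl

/-- Every tangent space unfolds to `E`, so vectors over propositionally equal base points can be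
compared without a cast. -/
theorem FinslerMetric.apply_congr {p q : M} (h : p = q) {v w : E} (hvw : v = w) :
    F p v = F q w := by
  subst h hvw
  rfl

variable {F}

theorem FinslerMetric.speed_congr {x y : ℝ → M} {S : Set ℝ} {s : ℝ} (hs : s ∈ S)
    (h : y =ᶠ[𝓝[S] s] x) : F.speed y S s = F.speed x S s :=
  F.apply_congr (h.self_of_nhdsWithin hs)
    (congrArg (fun A : ℝ →L[ℝ] E => A 1) (h.mfderivWithin_eq (h.self_of_nhdsWithin hs)))

theorem FinslerMetric.speed_eq_of_mem_nhdsWithin {x : ℝ → M} {A S : Set ℝ} {s : ℝ}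
    (h : MDifferentiableWithinAt 𝓘(ℝ, ℝ) 𝓘(ℝ, E) x A s) (hS : UniqueDiffWithinAt ℝ S s)
    (hA : A ∈ 𝓝[S] s) : F.speed x S s = F.speed x A s :=
  F.apply_congr rfl (congrArg (fun A : ℝ →L[ℝ] E => A 1)
    (mfderivWithin_eq_of_mem_nhdsWithin h hS hA))

theorem FinslerMetric.speed_affine {x : ℝ → M} {α β s : ℝ} (hα : 0 < α) {S : Set ℝ}
    (h : MDifferentiableWithinAt 𝓘(ℝ, ℝ) 𝓘(ℝ, E) x S (α * s + β))
    (hS : UniqueDiffWithinAt ℝ ((fun r => α * r + β) ⁻¹' S) s) :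
    F.speed (fun r => x (α * r + β)) ((fun r => α * r + β) ⁻¹' S) s =
      α * F.speed x S (α * s + β) :=
  (F.apply_congr rfl (mfderivWithin_affine h hS)).trans (F.homogeneous _ α hα _)

theorem FinslerMetric.continuousOn_speed [FiniteDimensional ℝ E] {x : ℝ → M} {a b : ℝ}
    (hab : a < b) (hx : ContMDiffOn 𝓘(ℝ, ℝ) 𝓘(ℝ, E) ∞ x (Icc a b)) :
    ContinuousOn (F.speed x (Icc a b)) (Icc a b) :=
  F.continuous.comp_continuousOn (continuousOn_velocity hab hx)

variable (F) in
/-- The curve `s ↦ (t s, x s)` is, on the side `S` of `s`, smooth with future-pointing causal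
velocity for the static spacetime with optical metric `F`. -/
def CausalGerm (t : ℝ → ℝ) (x : ℝ → M) (S : Set ℝ) (s : ℝ) : Prop :=
  (∃ U ∈ 𝓝 s, ContDiffOn ℝ ∞ t (S ∩ U) ∧ ContMDiffOn 𝓘(ℝ, ℝ) 𝓘(ℝ, E) ∞ x (S ∩ U)) ∧
    0 < derivWithin t S s ∧ F.speed x S s ≤ derivWithin t S s

theorem CausalGerm.congr {t t' : ℝ → ℝ} {x x' : ℝ → M} {S : Set ℝ} {s : ℝ}
    (h : CausalGerm F t x S s) (hs : s ∈ S) (ht : t' =ᶠ[𝓝[S] s] t) (hx : x' =ᶠ[𝓝[S] s] x) :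
    CausalGerm F t' x' S s := by
  obtain ⟨⟨U, hU, h1, h2⟩, h3, h4⟩ := h
  rw [CausalGerm, F.speed_congr hs hx, ht.derivWithin_eq (ht.self_of_nhdsWithin hs)]
  refine ⟨?_, h3, h4⟩
  obtain ⟨V, hV, hV'⟩ := mem_nhdsWithin_iff_exists_mem_nhds_inter.1 (ht.and hx)
  refine ⟨U ∩ V, inter_mem hU hV, ?_, ?_⟩
  · exact (h1.mono (inter_subset_inter_right _ inter_subset_left)).congr
      fun r hr => (hV' ⟨hr.2.2, hr.1⟩).1
  · exact (h2.mono (inter_subset_inter_right _ inter_subset_left)).congr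
      fun r hr => (hV' ⟨hr.2.2, hr.1⟩).2

theorem CausalGerm.differentiableWithinAt {t : ℝ → ℝ} {x : ℝ → M} {S : Set ℝ} {s : ℝ}
    (h : CausalGerm F t x S s) (hs : s ∈ S) : DifferentiableWithinAt ℝ t S s := by
  obtain ⟨⟨U, hU, h1, -⟩, -⟩ := h
  exact ((h1 s ⟨hs, mem_of_mem_nhds hU⟩).differentiableWithinAt (by simp)).mono_of_mem_nhdsWithin
    (inter_mem self_mem_nhdsWithin (mem_nhdsWithin_of_mem_nhds hU))

theorem CausalGerm.mdifferentiableWithinAt {t : ℝ → ℝ} {x : ℝ → M} {S : Set ℝ} {s : ℝ}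
    (h : CausalGerm F t x S s) (hs : s ∈ S) :
    MDifferentiableWithinAt 𝓘(ℝ, ℝ) 𝓘(ℝ, E) x S s := by
  obtain ⟨⟨U, hU, -, h2⟩, -⟩ := h
  exact ((h2 s ⟨hs, mem_of_mem_nhds hU⟩).mdifferentiableWithinAt
    (by simp)).mono_of_mem_nhdsWithin
    (inter_mem self_mem_nhdsWithin (mem_nhdsWithin_of_mem_nhds hU))

theorem CausalGerm.affine {t : ℝ → ℝ} {x : ℝ → M} {S : Set ℝ} {α β s : ℝ} (hα : 0 < α)
    (h : CausalGerm F t x S (α * s + β)) (hs : α * s + β ∈ S)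
    (hS : UniqueDiffWithinAt ℝ ((fun r => α * r + β) ⁻¹' S) s) :
    CausalGerm F (fun r => t (α * r + β)) (fun r => x (α * r + β))
      ((fun r => α * r + β) ⁻¹' S) s := by
  have hφ : ContDiff ℝ ∞ (fun r : ℝ => α * r + β) := by fun_prop
  have h1 : HasDerivAt (fun r : ℝ => α * r + β) α s := by
    simpa using ((hasDerivAt_id s).const_mul α).add_const β
  have h2 : derivWithin (fun r => t (α * r + β)) ((fun r => α * r + β) ⁻¹' S) s =
      α * derivWithin t S (α * s + β) := by
    rw [mul_comm]
    exact (HasDerivWithinAt.comp (h₂ := t) s (h.differentiableWithinAt hs).hasDerivWithinAt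
      (h1.hasDerivWithinAt (s := (fun r => α * r + β) ⁻¹' S)) (fun r hr => hr)).derivWithin hS
  have h5 := h.mdifferentiableWithinAt hs
  obtain ⟨⟨U, hU, hU1, hU2⟩, h3, h4⟩ := h
  refine ⟨⟨_, hφ.continuous.continuousAt.preimage_mem_nhds hU, ?_, ?_⟩, ?_, ?_⟩
  · exact hU1.comp hφ.contDiffOn fun r hr => hr
  · exact hU2.comp hφ.contMDiff.contMDiffOn fun r hr => hr
  · rw [h2]
    positivity
  · rw [h2, F.speed_affine hα h5 hS]
    exact mul_le_mul_of_nonneg_left h4 hα.le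

variable (F) in
/-- The curve `s ↦ (t s, x s)` is smooth with future-pointing causal velocity on both sides of the
parameters in `[c, d]`. -/
def IsCausalOn (t : ℝ → ℝ) (x : ℝ → M) (c d : ℝ) : Prop :=
  (∀ s ∈ Ico c d, CausalGerm F t x (Ici s) s) ∧ ∀ s ∈ Ioc c d, CausalGerm F t x (Iic s) s

theorem IsCausalOn.congr {t t' : ℝ → ℝ} {x x' : ℝ → M} {c d : ℝ} (h : IsCausalOn F t x c d)
    (ht : EqOn t' t (Icc c d)) (hx : EqOn x' x (Icc c d)) : IsCausalOn F t' x' c d := by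
  refine ⟨fun s hs => ?_, fun s hs => ?_⟩
  · have hn : Icc c d ∈ 𝓝[≥] s :=
      mem_of_superset (Icc_mem_nhdsGE hs.2) (Icc_subset_Icc_left hs.1)
    exact (h.1 s hs).congr self_mem_Ici (eventuallyEq_of_mem hn ht) (eventuallyEq_of_mem hn hx)
  · have hn : Icc c d ∈ 𝓝[≤] s :=
      mem_of_superset (Icc_mem_nhdsLE hs.1) (Icc_subset_Icc_right hs.2)
    exact (h.2 s hs).congr self_mem_Iic (eventuallyEq_of_mem hn ht) (eventuallyEq_of_mem hn hx)

theorem IsCausalOn.trans {t : ℝ → ℝ} {x : ℝ → M} {c d e : ℝ} (h : IsCausalOn F t x c d)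
    (h' : IsCausalOn F t x d e) : IsCausalOn F t x c e := by
  refine ⟨fun s hs => ?_, fun s hs => ?_⟩
  · rcases lt_or_ge s d with hd | hd
    exacts [h.1 s ⟨hs.1, hd⟩, h'.1 s ⟨hd, hs.2⟩]
  · rcases le_or_gt s d with hd | hd
    exacts [h.2 s ⟨hs.1, hd⟩, h'.2 s ⟨hd, hs.2⟩]

theorem IsCausalOn.affine {t : ℝ → ℝ} {x : ℝ → M} {c d α β : ℝ} (hα : 0 < α)
    (h : IsCausalOn F t x (α * c + β) (α * d + β)) :
    IsCausalOn F (fun r => t (α * r + β)) (fun r => x (α * r + β)) c d := by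
  refine ⟨fun s hs => ?_, fun s hs => ?_⟩
  · have hpre : (fun r => α * r + β) ⁻¹' (Ici (α * s + β)) = Ici s := by
      ext r
      simp [hα]
    have := (h.1 (α * s + β) ⟨by nlinarith [hs.1], by nlinarith [hs.2]⟩).affine hα self_mem_Ici
      (hpre ▸ uniqueDiffWithinAt_Ici s)
    rwa [hpre] at this
  · have hpre : (fun r => α * r + β) ⁻¹' (Iic (α * s + β)) = Iic s := by
      ext r
      simp [hα]
    have := (h.2 (α * s + β) ⟨by nlinarith [hs.1], by nlinarith [hs.2]⟩).affine hα self_mem_Iic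
      (hpre ▸ uniqueDiffWithinAt_Iic s)
    rwa [hpre] at this

theorem causalGerm_of_contMDiffOn {t : ℝ → ℝ} {x : ℝ → M} {a b s : ℝ} {S : Set ℝ}
    (ht : ContDiff ℝ ∞ t) (hx : ContMDiffOn 𝓘(ℝ, ℝ) 𝓘(ℝ, E) ∞ x (Icc a b)) (hs : s ∈ Icc a b)
    (hS : UniqueDiffWithinAt ℝ S s) (hA : Icc a b ∈ 𝓝[S] s) (h0 : 0 < deriv t s)
    (h : F.speed x (Icc a b) s ≤ deriv t s) : CausalGerm F t x S s := by
  have hd : derivWithin t S s = deriv t s :=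
    (ht.differentiable (by simp) s).derivWithin hS
  rw [CausalGerm, hd,
    F.speed_eq_of_mem_nhdsWithin ((hx s hs).mdifferentiableWithinAt (by simp)) hS hA]
  obtain ⟨V, hV, hV'⟩ := mem_nhdsWithin_iff_exists_mem_nhds_inter.1 hA
  exact ⟨⟨V, hV, ht.contDiffOn, hx.mono fun r hr => hV' ⟨hr.2, hr.1⟩⟩, h0, h⟩

/-- The right velocity and the velocity within `Icc a b` can differ only at `b`, where the former
looks outside the interval; one point is negligible. -/
theorem FinslerMetric.length_eq_integral_speed [FiniteDimensional ℝ E] {x : ℝ → M} {a b : ℝ}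
    (hab : a < b) (hx : ContMDiffOn 𝓘(ℝ, ℝ) 𝓘(ℝ, E) ∞ x (Icc a b)) :
    F.length x a b = ENNReal.ofReal (∫ s in a..b, F.speed x (Icc a b) s) := by
  have hint : IntegrableOn (F.speed x (Icc a b)) (Ioc a b) :=
    (F.continuousOn_speed hab hx).integrableOn_Icc.mono_set Ioc_subset_Icc_self
  rw [intervalIntegral.integral_of_le hab.le, ofReal_integral_eq_lintegral_ofReal hint
    (Eventually.of_forall fun s => F.nonneg _ _), F.length_eq_lintegral_speed,
    ← restrict_Ico_eq_restrict_Icc, ← restrict_Ico_eq_restrict_Ioc]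
  refine setLIntegral_congr_fun measurableSet_Ico fun s hs => ?_
  rw [F.speed_eq_of_mem_nhdsWithin
    ((hx s (Ico_subset_Icc_self hs)).mdifferentiableWithinAt (by simp))
    (uniqueDiffWithinAt_Ici s)
    (mem_of_superset (Icc_mem_nhdsGE hs.2) (Icc_subset_Icc_left hs.1))]

/-- The time needs a smooth derivative dominating the speed, with integral `R`. The speed is merely
continuous where the velocity vanishes, so it is replaced by a nearby polynomial plus the constant
that makes the integral exact. -/
theorem exists_isCausalOn_of_contMDiffOn [FiniteDimensional ℝ E] {x : ℝ → M} {a b R : ℝ}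
    (hab : a < b) (hx : ContMDiffOn 𝓘(ℝ, ℝ) 𝓘(ℝ, E) ∞ x (Icc a b))
    (hR : F.length x a b < ENNReal.ofReal R) (τ : ℝ) :
    ∃ t : ℝ → ℝ, t a = τ ∧ t b = τ + R ∧ IsCausalOn F t x a b := by
  set f := F.speed x (Icc a b)
  have hf : ContinuousOn f (Icc a b) := F.continuousOn_speed hab hx
  have hf0 : ∀ s, 0 ≤ f s := fun s => F.nonneg _ _
  have hI0 : 0 ≤ ∫ s in a..b, f s := intervalIntegral.integral_nonneg hab.le fun s _ => hf0 s
  rw [F.length_eq_integral_speed hab hx, ENNReal.ofReal_lt_ofReal_iff_of_nonneg hI0] at hR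
  have hba : 0 < b - a := sub_pos.2 hab
  -- A quarter of the mean slack: the approximation error costs at most `δ`, so the added constant
  -- `c` is at least `3 * δ` and `p + c` stays above the speed.
  set δ := (R - ∫ s in a..b, f s) / (4 * (b - a)) with hδ
  have hδ0 : 0 < δ := div_pos (sub_pos.2 hR) (by positivity)
  have hδ' : R - ∫ s in a..b, f s = 4 * (δ * (b - a)) := by
    rw [hδ]
    field_simp
  obtain ⟨p, hp⟩ := exists_polynomial_near_of_continuousOn a b f hf δ hδ0
  have hpi : IntervalIntegrable (fun s => p.eval s) volume a b :=
    p.continuous.intervalIntegrable a b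
  have hfi : IntervalIntegrable f volume a b := by
    rw [← uIcc_of_le hab.le] at hf
    exact hf.intervalIntegrable
  have hpI : ∫ s in a..b, p.eval s ≤ (∫ s in a..b, f s) + δ * (b - a) := by
    have h1 : ∫ s in a..b, p.eval s ≤ ∫ s in a..b, (f s + δ) := by
      refine intervalIntegral.integral_mono_on hab.le hpi
        (hfi.add intervalIntegrable_const) fun s hs => ?_
      have := abs_lt.1 (hp s hs)
      linarith [this.2]
    rw [intervalIntegral.integral_add hfi intervalIntegrable_const,
      intervalIntegral.integral_const, smul_eq_mul] at h1
    linarith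
  set c := (R - ∫ s in a..b, p.eval s) / (b - a) with hc
  have hc' : c * (b - a) = R - ∫ s in a..b, p.eval s := div_mul_cancel₀ _ hba.ne'
  have hc3 : 3 * δ ≤ c := by
    refine le_of_mul_le_mul_right ?_ hba
    rw [hc']
    linarith
  let q : ℝ → ℝ := fun s => p.eval s + c
  have hq : ContDiff ℝ ∞ q := by
    simpa [q] using (Polynomial.contDiff_aeval p ∞).add (contDiff_const (c := c))
  let t : ℝ → ℝ := fun s => τ + ∫ r in a..s, q r
  have ht' : ∀ s, HasDerivAt t (q s) s := fun s =>
    (intervalIntegral.integral_hasDerivAt_right (hq.continuous.intervalIntegrable a s)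
      hq.continuous.stronglyMeasurable.stronglyMeasurableAtFilter
      hq.continuous.continuousAt).const_add τ
  have hdt : deriv t = q := funext fun s => (ht' s).deriv
  have ht : ContDiff ℝ ∞ t :=
    contDiff_infty_iff_deriv.2 ⟨fun s => (ht' s).differentiableAt, hdt ▸ hq⟩
  have hqf : ∀ s ∈ Icc a b, f s + δ < q s := by
    intro s hs
    have := abs_lt.1 (hp s hs)
    change f s + δ < p.eval s + c
    linarith [this.1]
  have hgerm : ∀ s ∈ Icc a b, ∀ S, UniqueDiffWithinAt ℝ S s → Icc a b ∈ 𝓝[S] s →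
      CausalGerm F t x S s := by
    intro s hs S hS hA
    have h1 := hqf s hs
    refine causalGerm_of_contMDiffOn ht hx hs hS hA ?_ ?_ <;> rw [hdt]
    · linarith [hf0 s]
    · exact (by linarith : f s ≤ q s)
  refine ⟨t, by simp [t], ?_, fun s hs => ?_, fun s hs => ?_⟩
  · change τ + ∫ r in a..b, (p.eval r + c) = τ + R
    rw [intervalIntegral.integral_add hpi intervalIntegrable_const,
      intervalIntegral.integral_const, smul_eq_mul]
    linarith
  · exact hgerm s (Ico_subset_Icc_self hs) _ (uniqueDiffWithinAt_Ici s)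
      (mem_of_superset (Icc_mem_nhdsGE hs.2) (Icc_subset_Icc_left hs.1))
  · exact hgerm s (Ioc_subset_Icc_self hs) _ (uniqueDiffWithinAt_Iic s)
      (mem_of_superset (Icc_mem_nhdsLE hs.1) (Icc_subset_Icc_right hs.2))

theorem FinslerMetric.length_add (x : ℝ → M) {a p b : ℝ} (hap : a ≤ p) (hpb : p ≤ b) :
    F.length x a b = F.length x a p + F.length x p b := by
  rw [F.length_eq_lintegral_speed, F.length_eq_lintegral_speed, F.length_eq_lintegral_speed,
    ← restrict_Ioc_eq_restrict_Icc (a := p), ← Icc_union_Ioc_eq_Icc hap hpb]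
  refine lintegral_union measurableSet_Ioc ?_
  rw [disjoint_left]
  exact fun s hs hs' => absurd hs.2 (not_le.2 hs'.1)

/-- Induction on the number of interior breaks: cut at one of them and give each half its own length
plus half of the slack. A kink of the time at the cut is harmless, since only one-sided smoothness
is asked. -/
theorem exists_isCausalOn_of_breaks [FiniteDimensional ℝ E] {x : ℝ → M} {P : Set ℝ} (n : ℕ) :
    ∀ {a b R : ℝ}, a < b → (P ∩ Ioo a b).Finite → (P ∩ Ioo a b).ncard < n →
      (∀ c d : ℝ, c < d → Icc c d ⊆ Icc a b → Disjoint P (Ioo c d) →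
        ContMDiffOn 𝓘(ℝ, ℝ) 𝓘(ℝ, E) ∞ x (Icc c d)) →
      F.length x a b < ENNReal.ofReal R → ∀ τ : ℝ,
      ∃ t : ℝ → ℝ, t a = τ ∧ t b = τ + R ∧ IsCausalOn F t x a b := by
  induction n with
  | zero => exact fun _ _ h => absurd h (Nat.not_lt_zero _)
  | succ n ih =>
    intro a b R hab hfin hcard hx hR τ
    rcases (P ∩ Ioo a b).eq_empty_or_nonempty with hP | ⟨p, hpP, hp⟩
    · exact exists_isCausalOn_of_contMDiffOn hab
        (hx a b hab subset_rfl (disjoint_iff_inter_eq_empty.2 hP)) hR τ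
    · have hs1 : P ∩ Ioo a p ⊆ P ∩ Ioo a b :=
        inter_subset_inter_right _ (Ioo_subset_Ioo_right hp.2.le)
      have hs2 : P ∩ Ioo p b ⊆ P ∩ Ioo a b :=
        inter_subset_inter_right _ (Ioo_subset_Ioo_left hp.1.le)
      have hn1 : (P ∩ Ioo a p).ncard < (P ∩ Ioo a b).ncard :=
        ncard_lt_ncard (hs1.ssubset_of_mem_notMem ⟨hpP, hp⟩ fun h => lt_irrefl p h.2.2) hfin
      have hn2 : (P ∩ Ioo p b).ncard < (P ∩ Ioo a b).ncard :=
        ncard_lt_ncard (hs2.ssubset_of_mem_notMem ⟨hpP, hp⟩ fun h => lt_irrefl p h.2.1) hfin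
      rw [F.length_add x hp.1.le hp.2.le] at hR
      have hfin' := ENNReal.add_ne_top.1 (hR.trans ENNReal.ofReal_lt_top).ne
      rw [← ENNReal.ofReal_toReal hfin'.1, ← ENNReal.ofReal_toReal hfin'.2,
        ← ENNReal.ofReal_add ENNReal.toReal_nonneg ENNReal.toReal_nonneg,
        ENNReal.ofReal_lt_ofReal_iff_of_nonneg (by positivity)] at hR
      set ℓ₁ := (F.length x a p).toReal with hℓ₁
      set ℓ₂ := (F.length x p b).toReal with hℓ₂
      have hlt : ∀ (ℓ : ℝ≥0∞) (r : ℝ), ℓ ≠ ⊤ → ℓ.toReal < r → ℓ < ENNReal.ofReal r :=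
        fun ℓ r h hr => (ENNReal.lt_ofReal_iff_toReal_lt h).2 hr
      obtain ⟨t₁, ha₁, hb₁, h₁⟩ := ih (R := ℓ₁ + (R - ℓ₁ - ℓ₂) / 2) hp.1 (hfin.subset hs1)
        (by omega) (fun c d hcd hsub => hx c d hcd (hsub.trans (Icc_subset_Icc_right hp.2.le)))
        (hlt _ _ hfin'.1 (by linarith)) τ
      obtain ⟨t₂, ha₂, hb₂, h₂⟩ := ih (R := ℓ₂ + (R - ℓ₁ - ℓ₂) / 2) hp.2 (hfin.subset hs2)
        (by omega) (fun c d hcd hsub => hx c d hcd (hsub.trans (Icc_subset_Icc_left hp.1.le)))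
        (hlt _ _ hfin'.2 (by linarith)) (t₁ p)
      refine ⟨fun s => if s ≤ p then t₁ s else t₂ s, ?_, ?_, ?_⟩
      · simp [hp.1.le, ha₁]
      · simp only [not_le.2 hp.2, if_false, hb₂, hb₁]
        ring
      · refine IsCausalOn.trans (h₁.congr (fun s hs => ?_) fun _ _ => rfl)
          (h₂.congr (fun s hs => ?_) fun _ _ => rfl)
        · simp [hs.2]
        · rcases eq_or_lt_of_le hs.1 with rfl | h
          · simp [ha₂]
          · simp [not_le.2 h]

/-- The infimum is undercut by an actual curve; an affine change of parameter makes its interval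
`[c, c + 1]`, ready for gluing at the integers. -/
theorem exists_isCausalOn_of_dist_lt [FiniteDimensional ℝ E] {y z : M} {R : ℝ}
    (h : F.dist y z < ENNReal.ofReal R) (τ c : ℝ) :
    ∃ (t : ℝ → ℝ) (x : ℝ → M), t c = τ ∧ x c = y ∧ t (c + 1) = τ + R ∧ x (c + 1) = z ∧
      IsCausalOn F t x c (c + 1) := by
  obtain ⟨_, ⟨a, b, σ, hab, ⟨-, P, hP, hσ⟩, rfl, rfl, rfl⟩, hlt⟩ := sInf_lt_iff.1 h
  obtain ⟨t, ha, hb, ht⟩ := exists_isCausalOn_of_breaks _ hab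
    ((hP a b subset_rfl).subset (inter_subset_inter_right _ Ioo_subset_Icc_self))
    (Nat.lt_succ_self _) hσ hlt τ
  have e1 : (b - a) * c + (a - (b - a) * c) = a := by ring
  have e2 : (b - a) * (c + 1) + (a - (b - a) * c) = b := by ring
  refine ⟨fun r => t ((b - a) * r + (a - (b - a) * c)),
    fun r => σ ((b - a) * r + (a - (b - a) * c)), ?_, ?_, ?_, ?_,
    IsCausalOn.affine (sub_pos.2 hab) (by rwa [e1, e2])⟩ <;> simp only [e1, e2]
  exacts [ha, hb]

theorem exists_causal_curve_through [FiniteDimensional ℝ E] {τ : ℤ → ℝ} {y : ℤ → M}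
    (h : ∀ n, F.dist (y n) (y (n + 1)) < ENNReal.ofReal (τ (n + 1) - τ n)) :
    ∃ (t : ℝ → ℝ) (x : ℝ → M), (∀ n : ℤ, t n = τ n ∧ x n = y n) ∧
      ∀ s, CausalGerm F t x (Ici s) s ∧ CausalGerm F t x (Iic s) s := by
  have h' := fun n : ℤ => exists_isCausalOn_of_dist_lt (h n) (τ n) n
  choose t x h1 h2 h3 h4 h5 using h'
  -- At `s = n + 1` the floor selects the next piece, which starts where piece `n` ends.
  have key : ∀ n : ℤ, ∀ s ∈ Icc (n : ℝ) (n + 1),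
      t ⌊s⌋ s = t n s ∧ x ⌊s⌋ s = x n s := by
    intro n s hs
    rcases eq_or_lt_of_le hs.2 with rfl | hlt
    · have e : ⌊(n : ℝ) + 1⌋ = n + 1 := by
        rw [Int.floor_add_one, Int.floor_intCast]
      have e' : ((n + 1 : ℤ) : ℝ) = n + 1 := by push_cast; rfl
      have h1' := h1 (n + 1)
      have h2' := h2 (n + 1)
      rw [e'] at h1' h2'
      rw [e, h1', h2', h3, h4]
      simp
    · rw [Int.floor_eq_iff.2 ⟨hs.1, hlt⟩]
      simp
  have hc : ∀ n : ℤ, IsCausalOn F (fun s => t ⌊s⌋ s) (fun s => x ⌊s⌋ s) n (n + 1) := fun n =>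
    (h5 n).congr (fun s hs => (key n s hs).1) fun s hs => (key n s hs).2
  refine ⟨fun s => t ⌊s⌋ s, fun s => x ⌊s⌋ s, fun n => ?_, fun s => ⟨?_, ?_⟩⟩
  · simp [h1, h2]
  · exact (hc ⌊s⌋).1 s ⟨Int.floor_le s, Int.lt_floor_add_one s⟩
  -- For the left side, `⌈s⌉ - 1` is the integer `n` with `s ∈ (n, n + 1]`, also when `s` is an
  -- integer.
  · refine (hc (⌈s⌉ - 1)).2 s ⟨?_, ?_⟩
    · push_cast
      linarith [Int.ceil_lt_add_one s]
    · push_cast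
      linarith [Int.le_ceil s]

end CausalGerm

/-! ### Intervals with extended real end points, and the filters at their ends. -/

section OpenInterval

theorem ordConnected_openInterval (a b : EReal) : (openInterval a b).OrdConnected :=
  ⟨fun _ hx _ hy _ hz => ⟨hx.1.trans_le (EReal.coe_le_coe_iff.2 hz.1),
    (EReal.coe_le_coe_iff.2 hz.2).trans_lt hy.2⟩⟩

theorem comap_coe_nhdsLT_neBot {a b : EReal} (hab : a < b) :
    (comap ((↑) : ℝ → EReal) (𝓝[<] b)).NeBot := by
  refine comap_neBot_iff.2 fun t ht => ?_
  obtain ⟨c, hc, hct⟩ := (mem_nhdsLT_iff_exists_Ioo_subset' hab).1 ht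
  obtain ⟨x, hx1, hx2⟩ := EReal.lt_iff_exists_real_btwn.1 hc
  exact ⟨x, hct ⟨hx1, hx2⟩⟩

theorem comap_coe_nhdsGT_neBot {a b : EReal} (hab : a < b) :
    (comap ((↑) : ℝ → EReal) (𝓝[>] a)).NeBot := by
  refine comap_neBot_iff.2 fun t ht => ?_
  obtain ⟨c, hc, hct⟩ := (mem_nhdsGT_iff_exists_Ioo_subset' hab).1 ht
  obtain ⟨x, hx1, hx2⟩ := EReal.lt_iff_exists_real_btwn.1 hc
  exact ⟨x, hct ⟨hx1, hx2⟩⟩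

theorem openInterval_mem_comap_coe_nhdsLT {a b : EReal} (hab : a < b) :
    openInterval a b ∈ comap ((↑) : ℝ → EReal) (𝓝[<] b) :=
  preimage_mem_comap (Ioo_mem_nhdsLT hab)

theorem openInterval_mem_comap_coe_nhdsGT {a b : EReal} (hab : a < b) :
    openInterval a b ∈ comap ((↑) : ℝ → EReal) (𝓝[>] a) :=
  preimage_mem_comap (Ioo_mem_nhdsGT hab)

theorem tendsto_natCast_comap_coe_nhdsLT_top :
    Tendsto (fun n : ℕ => (n : ℝ)) atTop (comap ((↑) : ℝ → EReal) (𝓝[<] ⊤)) := by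
  refine tendsto_comap_iff.2 (tendsto_nhdsWithin_iff.2 ⟨?_, Eventually.of_forall fun n =>
    EReal.coe_lt_top _⟩)
  exact EReal.tendsto_coe_nhds_top_iff.2 tendsto_natCast_atTop_atTop

theorem tendsto_neg_natCast_comap_coe_nhdsGT_bot :
    Tendsto (fun n : ℕ => -(n : ℝ)) atTop (comap ((↑) : ℝ → EReal) (𝓝[>] ⊥)) := by
  refine tendsto_comap_iff.2 (tendsto_nhdsWithin_iff.2 ⟨?_, Eventually.of_forall fun n =>
    EReal.bot_lt_coe _⟩)
  exact EReal.tendsto_coe_nhds_bot_iff.2 (tendsto_neg_atTop_atBot.comp tendsto_natCast_atTop_atTop)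

end OpenInterval

section Slice

variable {E M : Type*} [NormedAddCommGroup E] [NormedSpace ℝ E] [TopologicalSpace M]
  [ChartedSpace E M]

theorem isTopologicalHypersurface_slice (t : ℝ) :
    IsTopologicalHypersurface (ℝ × E) (slice M t) := by
  intro p _
  refine ⟨(Homeomorph.addRight (-t)).toOpenPartialHomeomorph.prod (chartAt E p.2),
    ContinuousLinearMap.fst ℝ ℝ E, ?_, ?_, ?_⟩
  · simp
  · intro h
    have := congrArg (fun A : ℝ × E →L[ℝ] ℝ => A (1, 0)) h
    simp at this
  · intro q _
    simp [slice, add_neg_eq_zero]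

theorem PiecewiseSmoothOn.snd {γ : ℝ → ℝ × M} {J : Set ℝ}
    (h : PiecewiseSmoothOn (𝓘(ℝ, ℝ).prod 𝓘(ℝ, E)) γ J) :
    PiecewiseSmoothOn 𝓘(ℝ, E) (fun s => (γ s).2) J := by
  obtain ⟨hc, P, hP, hs⟩ := h
  exact ⟨continuous_snd.comp_continuousOn hc, P, hP, fun c d hcd hJ hd =>
    contMDiff_snd.comp_contMDiffOn (hs c d hcd hJ hd)⟩

end Slice

/-! ### Causal curves, completeness and Cauchy slices. -/

section Causality

variable {E M : Type*} [NormedAddCommGroup E] [NormedSpace ℝ E] [TopologicalSpace M]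
  [ChartedSpace E M] [IsManifold 𝓘(ℝ, E) ∞ M] {F : FinslerMetric E M} {Λ : M → ℝ}

theorem FinslerMetric.dist_self (F : FinslerMetric E M) (x : M) : F.dist x x = 0 := by
  refine le_antisymm (sInf_le ⟨0, 1, fun _ => x, zero_lt_one, ⟨continuousOn_const, ∅, by simp,
    fun _ _ _ _ _ => contMDiffOn_const⟩, rfl, rfl, ?_⟩) zero_le
  rw [F.length_eq_lintegral_speed]
  have h : ∀ s : ℝ, F.speed (fun _ => x) (Ici s) s = 0 := fun s =>
    (F.apply_congr rfl (congrArg (fun A : ℝ →L[ℝ] E => A 1) mfderivWithin_const)).trans (F.zero x)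
  simp [h]

variable (hΛ : ContMDiff 𝓘(ℝ, E) 𝓘(ℝ, ℝ) ∞ Λ) (hpos : ∀ x, 0 < Λ x)

include hΛ in
theorem IsFutureCausalVec.velocity {γ : ℝ → ℝ × M} {S : Set ℝ} {s : ℝ}
    (hS : UniqueDiffWithinAt ℝ S s)
    (h : IsFutureCausalVec (𝓘(ℝ, ℝ).prod 𝓘(ℝ, E)) (staticL F Λ) (timeField E M) (γ s)
      (mfderivWithin 𝓘(ℝ, ℝ) (𝓘(ℝ, ℝ).prod 𝓘(ℝ, E)) γ S s (1 : ℝ))) :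
    HasDerivWithinAt (fun r => (γ r).1) (derivWithin (fun r => (γ r).1) S s) S s ∧
      0 < derivWithin (fun r => (γ r).1) S s ∧
      (F.optical Λ hΛ hpos).speed (fun r => (γ r).2) S s ≤
        derivWithin (fun r => (γ r).1) S s := by
  have h1 := (isFutureCausalVec_staticL_iff hpos _ _).1 h
  have hd : MDifferentiableWithinAt 𝓘(ℝ, ℝ) (𝓘(ℝ, ℝ).prod 𝓘(ℝ, E)) γ S s := by
    -- Without differentiability the velocity would be the default value zero, whose time component
    -- is not positive.
    by_contra hd
    rw [mfderivWithin_zero_of_not_mdifferentiableWithinAt hd] at h1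
    exact lt_irrefl (0 : ℝ) h1.1
  have e := mfderivWithin_prod_apply_one hS hd
  have e1 := congrArg Prod.fst e
  have e2 := congrArg Prod.snd e
  have h2 : (F.optical Λ hΛ hpos).speed (fun r => (γ r).2) S s ≤
      (mfderivWithin 𝓘(ℝ, ℝ) (𝓘(ℝ, ℝ).prod 𝓘(ℝ, E)) γ S s (1 : ℝ) : ℝ × E).1 :=
    ((F.optical Λ hΛ hpos).apply_congr rfl e2.symm).trans_le h1.2
  rw [e1] at h2
  have h3 := h1.1
  rw [e1] at h3
  exact ⟨(derivWithin_zero_of_not_differentiableWithinAt.mt h3.ne' |> not_not.1).hasDerivWithinAt,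
    h3, h2⟩

theorem CausalGerm.isFutureCausalVec {t : ℝ → ℝ} {x : ℝ → M} {S : Set ℝ} {s : ℝ}
    (h : CausalGerm (F.optical Λ hΛ hpos) t x S s) (hs : s ∈ S) (hS : UniqueDiffWithinAt ℝ S s) :
    IsFutureCausalVec (𝓘(ℝ, ℝ).prod 𝓘(ℝ, E)) (staticL F Λ) (timeField E M) (t s, x s)
      (mfderivWithin 𝓘(ℝ, ℝ) (𝓘(ℝ, ℝ).prod 𝓘(ℝ, E)) (fun r => (t r, x r)) S s (1 : ℝ)) := by
  have hd : MDifferentiableWithinAt 𝓘(ℝ, ℝ) (𝓘(ℝ, ℝ).prod 𝓘(ℝ, E)) (fun r => (t r, x r)) S s :=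
    (h.differentiableWithinAt hs).mdifferentiableWithinAt.prodMk (h.mdifferentiableWithinAt hs)
  have e := mfderivWithin_prod_apply_one hS hd
  have e1 := congrArg Prod.fst e
  have e2 := congrArg Prod.snd e
  refine (isFutureCausalVec_staticL_iff hpos _ _).2 ⟨?_, ?_⟩
  · rw [e1]
    exact h.2.1
  · rw [e1]
    exact ((F.optical Λ hΛ hpos).apply_congr rfl e2).trans_le h.2.2

include hΛ in
/-- Along a future-pointing causal curve the time increases at least as fast as the optical
distance. -/
theorem IsFutureCausalCurve.lt_and_dist_le {γ : ℝ → ℝ × M} {a b : EReal}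
    (h : IsFutureCausalCurve (𝓘(ℝ, ℝ).prod 𝓘(ℝ, E)) (staticL F Λ) (timeField E M) γ a b)
    {s s' : ℝ} (hs : s ∈ openInterval a b) (hs' : s' ∈ openInterval a b) (hlt : s < s') :
    (γ s).1 < (γ s').1 ∧
      (F.optical Λ hΛ hpos).dist (γ s).2 (γ s').2 ≤ ENNReal.ofReal ((γ s').1 - (γ s).1) := by
  have hsub : Icc s s' ⊆ openInterval a b := (ordConnected_openInterval a b).out hs hs'
  let g' : ℝ → ℝ := fun r => derivWithin (fun r => (γ r).1) (Ici r) r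
  have hv := fun r (hr : r ∈ Icc s s') =>
    ((h.2 r (hsub hr)).1).velocity hΛ hpos (uniqueDiffWithinAt_Ici r)
  have hcont : ContinuousOn (fun r => (γ r).1) (Icc s s') :=
    continuous_fst.comp_continuousOn (h.1.1.mono hsub)
  have hder : ∀ r ∈ Ioo s s', HasDerivWithinAt (fun r => (γ r).1) (g' r) (Ioi r) r :=
    fun r hr => (hv r (Ioo_subset_Icc_self hr)).1.mono Ioi_subset_Ici_self
  have hgpos : ∀ r ∈ Ioo s s', 0 < g' r := fun r hr => (hv r (Ioo_subset_Icc_self hr)).2.1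
  -- A nonnegative right derivative of a continuous function is integrable, so the fundamental
  -- theorem applies across the breaks without subdividing.
  have hint : IntegrableOn g' (Ioc s s') :=
    intervalIntegral.integrableOn_deriv_right_of_nonneg hcont hder fun r hr => (hgpos r hr).le
  have hint' : IntervalIntegrable g' volume s s' :=
    (intervalIntegrable_iff_integrableOn_Ioc_of_le hlt.le).2 hint
  have hftc : ∫ r in s..s', g' r = (γ s').1 - (γ s).1 :=
    intervalIntegral.integral_eq_sub_of_hasDeriv_right_of_le hlt.le hcont hder hint'
  refine ⟨?_, ?_⟩
  · have := intervalIntegral.intervalIntegral_pos_of_pos_on hint' hgpos hlt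
    linarith
  · refine (sInf_le ⟨s, s', fun r => (γ r).2, hlt, h.1.snd.mono hsub, rfl, rfl, rfl⟩ :
      (F.optical Λ hΛ hpos).dist _ _ ≤ _).trans ?_
    rw [← hftc, intervalIntegral.integral_of_le hlt.le, ofReal_integral_eq_lintegral_ofReal hint
      ((ae_restrict_iff' measurableSet_Ioc).2 (Eventually.of_forall fun r hr =>
        (hv r (Ioc_subset_Icc_self hr)).2.1.le)),
      FinslerMetric.length_eq_lintegral_speed, restrict_Ioc_eq_restrict_Icc]
    exact setLIntegral_mono' measurableSet_Icc fun r hr => ENNReal.ofReal_le_ofReal (hv r hr).2.2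

variable [T2Space M]

include hΛ in
-- Bounded increasing times converge, and their differences bound the distances. Forward Cauchy is
-- sensitive to order, so the test sequences are restricted to increasing parameters.
theorem IsFutureCausalCurve.futureExtendible {γ : ℝ → ℝ × M} {a b : EReal} (hab : a < b)
    (h : IsFutureCausalCurve (𝓘(ℝ, ℝ).prod 𝓘(ℝ, E)) (staticL F Λ) (timeField E M) γ a b)
    (hc : (F.optical Λ hΛ hpos).IsForwardComplete) {C : ℝ}
    (hC : ∀ s ∈ openInterval a b, (γ s).1 ≤ C) : FutureExtendible γ b := by
  have := comap_coe_nhdsLT_neBot hab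
  refine exists_tendsto_of_forall_seq
    (R := fun _ s s' => s ∈ openInterval a b ∧ s' ∈ openInterval a b ∧ s < s') ?_ ?_
  · intro _
    filter_upwards [openInterval_mem_comap_coe_nhdsLT hab] with s hs
    filter_upwards [openInterval_mem_comap_coe_nhdsLT hab,
      openInterval_mem_comap_coe_nhdsLT hs.2] with s' h1 h2
    exact ⟨hs, h1, EReal.coe_lt_coe_iff.1 h2.1⟩
  · intro u _ hR
    have hu : StrictMono u := strictMono_nat_of_lt_succ fun n => (hR n).2.2
    have hle := fun j k (hjk : j < k) =>
      h.lt_and_dist_le hΛ hpos (hR j).1 (hR k).1 (hu hjk)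
    have ht : StrictMono fun n => (γ (u n)).1 := fun j k hjk => (hle j k hjk).1
    have hlim := tendsto_atTop_ciSup ht.monotone
      ⟨C, by rintro _ ⟨n, rfl⟩; exact hC _ (hR n).1⟩
    obtain ⟨x₀, hx₀⟩ := hc (fun n => (γ (u n)).2) fun ε hε => by
      obtain ⟨ν, hν⟩ := Metric.cauchySeq_iff.1 hlim.cauchySeq ε hε
      refine ⟨ν, fun j k hj hjk => (hle j k hjk).2.trans_lt ?_⟩
      exact (ENNReal.ofReal_lt_ofReal_iff hε).2
        (lt_of_abs_lt (hν k (hj.trans hjk.le) j hj))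
    exact ⟨_, hlim.prodMk_nhds hx₀⟩

include hΛ in
-- With decreasing parameters the distance estimate runs from the later term to the earlier one,
-- which is the backward Cauchy condition.
theorem IsFutureCausalCurve.pastExtendible {γ : ℝ → ℝ × M} {a b : EReal} (hab : a < b)
    (h : IsFutureCausalCurve (𝓘(ℝ, ℝ).prod 𝓘(ℝ, E)) (staticL F Λ) (timeField E M) γ a b)
    (hc : (F.optical Λ hΛ hpos).IsBackwardComplete) {C : ℝ}
    (hC : ∀ s ∈ openInterval a b, C ≤ (γ s).1) : PastExtendible γ a := by
  have := comap_coe_nhdsGT_neBot hab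
  refine exists_tendsto_of_forall_seq
    (R := fun _ s s' => s ∈ openInterval a b ∧ s' ∈ openInterval a b ∧ s' < s) ?_ ?_
  · intro _
    filter_upwards [openInterval_mem_comap_coe_nhdsGT hab] with s hs
    filter_upwards [openInterval_mem_comap_coe_nhdsGT hab,
      openInterval_mem_comap_coe_nhdsGT hs.1] with s' h1 h2
    exact ⟨hs, h1, EReal.coe_lt_coe_iff.1 h2.2⟩
  · intro u _ hR
    have hu : StrictAnti u := strictAnti_nat_of_succ_lt fun n => (hR n).2.2
    have hle := fun j k (hjk : j < k) =>
      h.lt_and_dist_le hΛ hpos (hR k).1 (hR j).1 (hu hjk)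
    have ht : StrictAnti fun n => (γ (u n)).1 := fun j k hjk => (hle j k hjk).1
    have hlim := tendsto_atTop_ciInf ht.antitone
      ⟨C, by rintro _ ⟨n, rfl⟩; exact hC _ (hR n).1⟩
    obtain ⟨x₀, hx₀⟩ := hc (fun n => (γ (u n)).2) fun ε hε => by
      obtain ⟨ν, hν⟩ := Metric.cauchySeq_iff.1 hlim.cauchySeq ε hε
      refine ⟨ν, fun j k hj hjk => (hle j k hjk).2.trans_lt ?_⟩
      exact (ENNReal.ofReal_lt_ofReal_iff hε).2
        (lt_of_abs_lt (hν j hj k (hj.trans hjk.le)))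
    exact ⟨_, hlim.prodMk_nhds hx₀⟩

theorem isCauchyHypersurface_slice (hf : (F.optical Λ hΛ hpos).IsForwardComplete)
    (hb : (F.optical Λ hΛ hpos).IsBackwardComplete) (t : ℝ) :
    IsCauchyHypersurface (𝓘(ℝ, ℝ).prod 𝓘(ℝ, E)) (staticL F Λ) (timeField E M) (slice M t) := by
  refine ⟨isTopologicalHypersurface_slice t, fun a b γ hab hγ hfut hpast => ?_⟩
  have hmono : StrictMonoOn (fun s => (γ s).1) (openInterval a b) := fun s hs s' hs' hlt =>
    (hγ.lt_and_dist_le hΛ hpos hs hs' hlt).1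
  obtain ⟨s₁, hs₁, h₁⟩ : ∃ s ∈ openInterval a b, t < (γ s).1 := by
    by_contra! hcon
    exact hfut (hγ.futureExtendible hΛ hpos hab hf hcon)
  obtain ⟨s₂, hs₂, h₂⟩ : ∃ s ∈ openInterval a b, (γ s).1 < t := by
    by_contra! hcon
    exact hpast (hγ.pastExtendible hΛ hpos hab hb hcon)
  have hconn : IsPreconnected (openInterval a b) :=
    (ordConnected_openInterval a b).isPreconnected
  obtain ⟨s, hs, hst⟩ := hconn.intermediate_value hs₂ hs₁
    (continuous_fst.comp_continuousOn hγ.1.1) ⟨h₂.le, h₁.le⟩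
  refine ⟨s, ⟨hs, hst, mem_univ _⟩, fun s' hs' => hmono.injOn hs'.1 hs ?_⟩
  exact (mem_singleton_iff.1 hs'.2.1).trans hst.symm

variable [FiniteDimensional ℝ E]

omit [T2Space M] in
theorem exists_isFutureCausalCurve_through {τ : ℤ → ℝ} {y : ℤ → M}
    (h : ∀ n, (F.optical Λ hΛ hpos).dist (y n) (y (n + 1)) <
      ENNReal.ofReal (τ (n + 1) - τ n)) :
    ∃ γ : ℝ → ℝ × M, (∀ n : ℤ, γ n = (τ n, y n)) ∧
      IsFutureCausalCurve (𝓘(ℝ, ℝ).prod 𝓘(ℝ, E)) (staticL F Λ) (timeField E M) γ ⊥ ⊤ := by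
  obtain ⟨t, x, h1, h2⟩ := exists_causal_curve_through h
  refine ⟨fun s => (t s, x s), fun n => Prod.ext (h1 n).1 (h1 n).2,
    piecewiseSmoothOn_of_forall_sides ?_ ?_ _, fun s _ => ⟨?_, ?_⟩⟩
  · intro s
    obtain ⟨U, hU, hU1, hU2⟩ := (h2 s).1.1
    exact ⟨U, hU, hU1.contMDiffOn.prodMk hU2⟩
  · intro s
    obtain ⟨U, hU, hU1, hU2⟩ := (h2 s).2.1
    exact ⟨U, hU, hU1.contMDiffOn.prodMk hU2⟩
  · exact (h2 s).1.isFutureCausalVec hΛ hpos self_mem_Ici (uniqueDiffWithinAt_Ici s)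
  · exact (h2 s).2.isFutureCausalVec hΛ hpos self_mem_Iic (uniqueDiffWithinAt_Iic s)

theorem isForwardComplete_of_isCauchyHypersurface {t₀ : ℝ}
    (h : IsCauchyHypersurface (𝓘(ℝ, ℝ).prod 𝓘(ℝ, E)) (staticL F Λ) (timeField E M)
      (slice M t₀)) : (F.optical Λ hΛ hpos).IsForwardComplete := by
  intro y hy
  refine exists_tendsto_of_forall_seq (R := fun n j k =>
    (F.optical Λ hΛ hpos).dist (y j) (y k) < ENNReal.ofReal ((1 / 2) ^ n)) ?_ ?_
  · intro n
    obtain ⟨ν, hν⟩ := hy ((1 / 2) ^ n) (by positivity)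
    filter_upwards [eventually_ge_atTop ν] with j hj
    filter_upwards [eventually_gt_atTop j] with k hk using hν j k hj hk
  · intro u _ hR
    by_contra hcon
    -- The steps are `2⁻ⁿ` for `n ≥ 0`, matching the distance bounds and accumulating at `t₀` from
    -- below. For `n < 0` the steps are `1`, with the same base point at each such integer.
    let τ : ℤ → ℝ := fun n => t₀ - 2 * (1 / 2) ^ n.toNat + (min n 0 : ℤ)
    have hdist : ∀ n : ℤ, (F.optical Λ hΛ hpos).dist (y (u n.toNat)) (y (u (n + 1).toNat)) <
        ENNReal.ofReal (τ (n + 1) - τ n) := by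
      intro n
      rcases lt_or_ge n 0 with hn | hn
      · have e : τ (n + 1) - τ n = 1 := by
          simp only [τ, min_eq_left hn.le, min_eq_left (show n + 1 ≤ 0 by omega),
            Int.toNat_of_nonpos hn.le, Int.toNat_of_nonpos (show n + 1 ≤ 0 by omega)]
          push_cast
          ring
        rw [e, Int.toNat_of_nonpos hn.le, Int.toNat_of_nonpos (show n + 1 ≤ 0 by omega),
          FinslerMetric.dist_self]
        simp
      · have e : τ (n + 1) - τ n = (1 / 2) ^ n.toNat := by
          simp only [τ, min_eq_right hn, min_eq_right (show 0 ≤ n + 1 by omega),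
            show (n + 1).toNat = n.toNat + 1 by omega, pow_succ]
          ring
        rw [e, show (n + 1).toNat = n.toNat + 1 by omega]
        exact hR n.toNat
    obtain ⟨γ, hγn, hγ⟩ := exists_isFutureCausalCurve_through hΛ hpos
      (y := fun n : ℤ => y (u n.toNat)) hdist
    have hfut : ¬ FutureExtendible γ ⊤ := by
      rintro ⟨p, hp⟩
      refine hcon ⟨p.2, (((continuous_snd.tendsto p).comp hp).comp
        tendsto_natCast_comap_coe_nhdsLT_top).congr fun n => ?_⟩
      have h2 := hγn n
      rw [Int.cast_natCast] at h2
      simp [h2]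
    have hpast : ¬ PastExtendible γ ⊥ := by
      rintro ⟨p, hp⟩
      have h1 := ((continuous_fst.tendsto p).comp hp).comp
        tendsto_neg_natCast_comap_coe_nhdsGT_bot
      refine not_tendsto_nhds_of_tendsto_atBot (f := fun n : ℕ => t₀ - 2 + -(n : ℝ)) ?_ p.1
        (h1.congr fun n => ?_)
      · exact tendsto_atBot_add_const_left _ _
          (tendsto_neg_atTop_atBot.comp tendsto_natCast_atTop_atTop)
      · have h2 := hγn (-n)
        rw [Int.cast_neg, Int.cast_natCast] at h2
        simp [h2, τ]
    obtain ⟨s, ⟨hs, hst, -⟩, -⟩ := h.2 ⊥ ⊤ γ bot_lt_top hγ hfut hpast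
    -- After the crossing parameter `s` time exceeds `t₀`, yet at a natural number `n > s` it is `t₀
    -- - 2 * 2⁻ⁿ`.
    obtain ⟨n, hn⟩ := exists_nat_gt s
    have h1 := (hγ.lt_and_dist_le hΛ hpos hs (s' := n)
      ⟨EReal.bot_lt_coe _, EReal.coe_lt_top _⟩ hn).1
    have h2 := hγn n
    rw [Int.cast_natCast] at h2
    rw [mem_singleton_iff.1 hst, h2] at h1
    have h3 : (0 : ℝ) < (2 ^ n)⁻¹ := by positivity
    simp [τ] at h1
    linarith

theorem isBackwardComplete_of_isCauchyHypersurface {t₀ : ℝ}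
    (h : IsCauchyHypersurface (𝓘(ℝ, ℝ).prod 𝓘(ℝ, E)) (staticL F Λ) (timeField E M)
      (slice M t₀)) : (F.optical Λ hΛ hpos).IsBackwardComplete := by
  intro y hy
  refine exists_tendsto_of_forall_seq (R := fun n j k =>
    (F.optical Λ hΛ hpos).dist (y k) (y j) < ENNReal.ofReal ((1 / 2) ^ n)) ?_ ?_
  · intro n
    obtain ⟨ν, hν⟩ := hy ((1 / 2) ^ n) (by positivity)
    filter_upwards [eventually_ge_atTop ν] with j hj
    filter_upwards [eventually_gt_atTop j] with k hk using hν j k hj hk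
  · intro u _ hR
    by_contra hcon
    -- Mirror image: the curve runs through the terms in reverse order, its times decreasing to `t₀`
    -- in the past; after parameter `0` it takes unit steps back to the first term.
    let τ : ℤ → ℝ := fun n => t₀ + 2 * (1 / 2) ^ (-n).toNat + (max n 0 : ℤ)
    have hdist : ∀ n : ℤ, (F.optical Λ hΛ hpos).dist (y (u (-n).toNat))
        (y (u (-(n + 1)).toNat)) < ENNReal.ofReal (τ (n + 1) - τ n) := by
      intro n
      rcases lt_or_ge n 0 with hn | hn
      · have e0 : (-n).toNat = (-(n + 1)).toNat + 1 := by omega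
        have e : τ (n + 1) - τ n = (1 / 2) ^ (-(n + 1)).toNat := by
          simp only [τ, max_eq_right hn.le, max_eq_right (show n + 1 ≤ 0 by omega), e0, pow_succ]
          ring
        rw [e, e0]
        exact hR _
      · have e : τ (n + 1) - τ n = 1 := by
          simp only [τ, max_eq_left hn, max_eq_left (show 0 ≤ n + 1 by omega),
            Int.toNat_of_nonpos (show -n ≤ 0 by omega),
            Int.toNat_of_nonpos (show -(n + 1) ≤ 0 by omega)]
          push_cast
          ring
        rw [e, Int.toNat_of_nonpos (show -n ≤ 0 by omega),
          Int.toNat_of_nonpos (show -(n + 1) ≤ 0 by omega), FinslerMetric.dist_self]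
        simp
    obtain ⟨γ, hγn, hγ⟩ := exists_isFutureCausalCurve_through hΛ hpos
      (y := fun n : ℤ => y (u (-n).toNat)) hdist
    have hfut : ¬ FutureExtendible γ ⊤ := by
      rintro ⟨p, hp⟩
      have h1 := ((continuous_fst.tendsto p).comp hp).comp
        tendsto_natCast_comap_coe_nhdsLT_top
      refine not_tendsto_nhds_of_tendsto_atTop (f := fun n : ℕ => t₀ + 2 + (n : ℝ)) ?_ p.1
        (h1.congr fun n => ?_)
      · exact tendsto_atTop_add_const_left _ _ tendsto_natCast_atTop_atTop
      · have h2 := hγn n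
        rw [Int.cast_natCast] at h2
        simp [h2, τ]
    have hpast : ¬ PastExtendible γ ⊥ := by
      rintro ⟨p, hp⟩
      refine hcon ⟨p.2, (((continuous_snd.tendsto p).comp hp).comp
        tendsto_neg_natCast_comap_coe_nhdsGT_bot).congr fun n => ?_⟩
      have h2 := hγn (-n)
      rw [Int.cast_neg, Int.cast_natCast] at h2
      simp [h2]
    obtain ⟨s, ⟨hs, hst, -⟩, -⟩ := h.2 ⊥ ⊤ γ bot_lt_top hγ hfut hpast
    obtain ⟨n, hn⟩ := exists_nat_gt (-s)
    have h1 := (hγ.lt_and_dist_le hΛ hpos (s := -n) (s' := s)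
      ⟨EReal.bot_lt_coe _, EReal.coe_lt_top _⟩ hs (by linarith)).1
    have h2 := hγn (-n)
    rw [Int.cast_neg, Int.cast_natCast] at h2
    rw [mem_singleton_iff.1 hst, h2] at h1
    have h3 : (0 : ℝ) < (2 ^ n)⁻¹ := by positivity
    simp [τ] at h1
    linarith

end Causality

end StaticFinsler

end

theorem mainTheorem1 {E M : Type*} [NormedAddCommGroup E] [NormedSpace ℝ E]
    [FiniteDimensional ℝ E] (hdim : 1 ≤ Module.finrank ℝ E)
    [TopologicalSpace M] [T2Space M] [ParacompactSpace M] [ConnectedSpace M]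
    [ChartedSpace E M] [IsManifold 𝓘(ℝ, E) ∞ M]
    (F : StaticFinsler.FinslerMetric E M)
    (Λ : M → ℝ) (hΛ : ContMDiff 𝓘(ℝ, E) 𝓘(ℝ, ℝ) ∞ Λ) (hpos : ∀ x, 0 < Λ x) (t : ℝ) :
    (StaticFinsler.IsCauchyHypersurface (𝓘(ℝ, ℝ).prod 𝓘(ℝ, E))
        (StaticFinsler.staticL F Λ) (StaticFinsler.timeField E M) (StaticFinsler.slice M t) ↔
      (F.optical Λ hΛ hpos).IsForwardComplete ∧ (F.optical Λ hΛ hpos).IsBackwardComplete) ∧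
    (StaticFinsler.IsCauchyHypersurface (𝓘(ℝ, ℝ).prod 𝓘(ℝ, E))
        (StaticFinsler.staticL F Λ) (StaticFinsler.timeField E M) (StaticFinsler.slice M t) →
      ∀ t' : ℝ, StaticFinsler.IsCauchyHypersurface (𝓘(ℝ, ℝ).prod 𝓘(ℝ, E))
        (StaticFinsler.staticL F Λ) (StaticFinsler.timeField E M) (StaticFinsler.slice M t')) := by
  have key : ∀ t : ℝ, StaticFinsler.IsCauchyHypersurface (𝓘(ℝ, ℝ).prod 𝓘(ℝ, E))
      (StaticFinsler.staticL F Λ) (StaticFinsler.timeField E M) (StaticFinsler.slice M t) ↔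
      (F.optical Λ hΛ hpos).IsForwardComplete ∧ (F.optical Λ hΛ hpos).IsBackwardComplete :=
    fun t => ⟨fun h => ⟨StaticFinsler.isForwardComplete_of_isCauchyHypersurface hΛ hpos h,
      StaticFinsler.isBackwardComplete_of_isCauchyHypersurface hΛ hpos h⟩,
      fun h => StaticFinsler.isCauchyHypersurface_slice hΛ hpos h.1 h.2 t⟩
  exact ⟨key t, fun h t' => (key t').2 ((key t).1 h)⟩
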